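/- Let $l,n\ge 0$ be integers, let $T=(\mathbb{C}^*)^l$ act on itself by multiplication, let $\mathbb{C}[T]=\mathbb{C}[t_1^{\pm1},\dots,t_l^{\pm1}]$ be its coordinate ring, $D(T)$ the algebra of algebraic differential operators on $T$, and $\operatorname{Lie}T$ the Lie algebra of invariant vector fields on $T$, with basis $\theta_i=t_i\partial_{t_i}$ $(1\le i\le l)$. For a matrix $\alpha\in M_n(\Omega_{\mathbb{C}[T]})$ of Kähler 1-forms that is flat, i.e. $d\alpha+\alpha\wedge\alpha=0$, let $\mathbb{M}_\alpha$ be the $D(T)$-module $\mathbb{C}[T]^{\oplus n}$ whose structure extends the $\mathbb{C}[T]$-module structure and satisfies $v(e_1,\dots,e_n)=(e_1,\dots,e_n)\,\alpha(v)$ for every vector field $v\in\operatorname{Der}_{\mathbb{C}}(\mathbb{C}[T])$, where $e_1,\dots,e_n$ is the standard basis. An invariant D-module of rank $n$ over $T$ is a $D(T)$-module of the form $\mathbb{M}_\alpha$ with $\alpha$ flat and $T$-invariant. Let $C_l(\mathrm{GL}_n(\mathbb{C}))$ be the set of $l$-tuples of pairwise commuting invertible $n\times n$ matrices, on which $\mathrm{GL}_n(\mathbb{C})$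 acts by simultaneous conjugation. Each representation $\rho\in\operatorname{Hom}_{\text{Lie alg}}(\operatorname{Lie}T,\mathfrak{gl}_n(\mathbb{C}))$ determines a unique invariant D-module $\mathbb{M}_\rho=\mathbb{M}_{\alpha_\rho}$ of rank $n$ with $\alpha_\rho(v)=\rho(v)$ for all $v\in\operatorname{Lie}T$, and $\rho\mapsto\mathbb{M}_\rho$ is a bijection from $\operatorname{Hom}_{\text{Lie alg}}(\operatorname{Lie}T,\mathfrak{gl}_n(\mathbb{C}))$ onto the set of invariant D-modules of rank $n$ over $T$. Consider the exponential map $$\operatorname{Exp}:\operatorname{Hom}_{\text{Lie alg}}(\operatorname{Lie}T,\mathfrak{gl}_n(\mathbb{C}))\to C_l(\mathrm{GL}_n(\mathbb{C}))/\mathrm{GL}_n(\mathbb{C}),\qquad \operatorname{Exp}(\rho)=\big[\big(\exp(2\pi i\,\rho(\theta_1)),\dots,\exp(2\pi i\,\rho(\theta_l))\big)\big].$$ Then $\operatorname{Exp}$ is surjective; for all $\rho,\sigma$ one has $\operatorname{Exp}(\rho)=\operatorname{Exp}(\sigma)$ if and only if $\mathbb{M}_\rho\cong\mathbb{M}_\sigma$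 as $D(T)$-modules, so that the fibers of $\operatorname{Exp}$ are exactly the isomorphism classes of invariant D-modules of rank $n$ over $T$; and $[\mathbb{M}_\rho]\mapsto\operatorname{Exp}(\rho)$ is a well-defined bijection $$\{\text{invariant D-modules of rank } n \text{ over } T\}/\!\cong\;\;\longrightarrow\;\; C_l(\mathrm{GL}_n(\mathbb{C}))/\mathrm{GL}_n(\mathbb{C}).$$ -/

import Mathlib

open scoped KaehlerDifferential

noncomputable section

namespace InvDMod

/-! ### Algebraic differential operators -/

section DiffOp

variable (k : Type*) [CommRing k] {A : Type*} [CommRing A] [Algebra k A]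

/-- Multiplication by `a : A`, as a `k`-linear endomorphism of `A`. -/
abbrev mulOp (a : A) : Module.End k A := LinearMap.mulLeft k a

/-- `P` is a differential operator of order at most `m` on the `k`-algebra `A`
(Grothendieck's definition): all `(m+1)`-fold commutators of `P` with multiplication operators
vanish. -/
def IsDiffOpOfOrder : ℕ → Module.End k A → Prop
  | 0, P => ∀ a : A, P * mulOp k a - mulOp k a * P = 0
  | m + 1, P => ∀ a : A, IsDiffOpOfOrder m (P * mulOp k a - mulOp k a * P)

variable {k}

lemma IsDiffOpOfOrder.zero (m : ℕ) : IsDiffOpOfOrder k m (0 : Module.End k A) := by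
  induction m with
  | zero => intro a; simp
  | succ m ih => intro a; simpa using ih

lemma IsDiffOpOfOrder.succ {m : ℕ} {P : Module.End k A} (h : IsDiffOpOfOrder k m P) :
    IsDiffOpOfOrder k (m + 1) P := by
  induction m generalizing P with
  | zero => intro a; rw [h a]; exact IsDiffOpOfOrder.zero 0
  | succ m ih => intro a; exact ih (h a)

lemma IsDiffOpOfOrder.mono {m m' : ℕ} (hm : m ≤ m') {P : Module.End k A}
    (h : IsDiffOpOfOrder k m P) : IsDiffOpOfOrder k m' P := by
  induction hm with
  | refl => exact h
  | step _ ih => exact ih.succ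

lemma IsDiffOpOfOrder.add {m : ℕ} {P Q : Module.End k A} (hP : IsDiffOpOfOrder k m P)
    (hQ : IsDiffOpOfOrder k m Q) : IsDiffOpOfOrder k m (P + Q) := by
  induction m generalizing P Q with
  | zero =>
    intro a
    have h : (P + Q) * mulOp k a - mulOp k a * (P + Q)
        = (P * mulOp k a - mulOp k a * P) + (Q * mulOp k a - mulOp k a * Q) := by noncomm_ring
    rw [h, hP a, hQ a, add_zero]
  | succ m ih =>
    intro a
    have h : (P + Q) * mulOp k a - mulOp k a * (P + Q)
        = (P * mulOp k a - mulOp k a * P) + (Q * mulOp k a - mulOp k a * Q) := by noncomm_ring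
    rw [h]
    exact ih (hP a) (hQ a)

lemma commutator_mul (P Q M : Module.End k A) :
    P * Q * M - M * (P * Q) = P * (Q * M - M * Q) + (P * M - M * P) * Q := by
  simp only [mul_sub, sub_mul, mul_assoc]; abel

lemma IsDiffOpOfOrder.mul {m m' : ℕ} {P Q : Module.End k A} (hP : IsDiffOpOfOrder k m P)
    (hQ : IsDiffOpOfOrder k m' Q) : IsDiffOpOfOrder k (m + m') (P * Q) := by
  induction h : m + m' generalizing m m' P Q with
  | zero =>
    obtain ⟨rfl, rfl⟩ : m = 0 ∧ m' = 0 := by omega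
    intro a
    rw [commutator_mul, hP a, hQ a]; simp
  | succ s ih =>
    intro a
    rw [commutator_mul]
    refine IsDiffOpOfOrder.add ?_ ?_
    · cases m' with
      | zero => rw [hQ a]; simpa using IsDiffOpOfOrder.zero s
      | succ m' => exact ih hP (hQ a) (by omega)
    · cases m with
      | zero => rw [hP a]; simpa using IsDiffOpOfOrder.zero s
      | succ m => exact ih (hP a) hQ (by omega)

lemma isDiffOpOfOrder_mulOp (a : A) : IsDiffOpOfOrder k 0 (mulOp k a) := by
  intro b
  ext x
  simp only [LinearMap.sub_apply, Module.End.mul_apply, LinearMap.mulLeft_apply,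
    LinearMap.zero_apply]
  ring

lemma isDiffOpOfOrder_derivation (v : Derivation k A A) :
    IsDiffOpOfOrder k 1 (v : Module.End k A) := by
  intro a
  have h : (v : Module.End k A) * mulOp k a - mulOp k a * (v : Module.End k A)
      = mulOp k (v a) := by
    ext x
    simp [mul_comm]
  rw [h]
  exact isDiffOpOfOrder_mulOp _

variable (k A)

/-- The algebra `D(A)` of `k`-linear differential operators (of any finite order) on the
`k`-algebra `A`, as a subalgebra of `End_k(A)`. -/
def diffOps : Subalgebra k (Module.End k A) where
  carrier := {P | ∃ m, IsDiffOpOfOrder k m P}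
  mul_mem' := by
    rintro P Q ⟨m, hP⟩ ⟨m', hQ⟩
    exact ⟨m + m', hP.mul hQ⟩
  add_mem' := by
    rintro P Q ⟨m, hP⟩ ⟨m', hQ⟩
    exact ⟨max m m', (hP.mono (le_max_left _ _)).add (hQ.mono (le_max_right _ _))⟩
  algebraMap_mem' := by
    intro c
    refine ⟨0, ?_⟩
    have h : algebraMap k (Module.End k A) c = mulOp k (algebraMap k A c) := by
      ext x
      simp [Algebra.smul_def]
    rw [h]
    exact isDiffOpOfOrder_mulOp _

variable {A}

/-- A function `f : A`, as a differential operator of order zero. -/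
def funOp (f : A) : diffOps k A := ⟨mulOp k f, 0, isDiffOpOfOrder_mulOp f⟩

variable {k}

/-- A vector field (derivation) on `A`, as a differential operator. -/
def derOp (v : Derivation k A A) : diffOps k A := ⟨v, 1, isDiffOpOfOrder_derivation v⟩

end DiffOp

/-! ### Kähler differential forms -/

section Forms

variable {k : Type*} [CommRing k] {A : Type*} [CommRing A] [Algebra k A]

/-- The wedge product `ω ∧ η ∈ Ω² = ⋀²Ω` of two Kähler 1-forms. -/
def wedge (ω η : Ω[A⁄k]) : ⋀[A]^2 Ω[A⁄k] := exteriorPower.ιMulti A 2 ![ω, η]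

lemma wedge_add_left (ω ω' η : Ω[A⁄k]) : wedge (ω + ω') η = wedge ω η + wedge ω' η := by
  simpa [wedge] using
    (exteriorPower.ιMulti A 2 (M := Ω[A⁄k])).map_vecCons_add ![η] ω ω'

lemma wedge_smul_left (f : A) (ω η : Ω[A⁄k]) : wedge (f • ω) η = f • wedge ω η := by
  simpa [wedge] using
    (exteriorPower.ιMulti A 2 (M := Ω[A⁄k])).map_vecCons_smul ![η] f ω

lemma wedge_self (ω : Ω[A⁄k]) : wedge ω ω = 0 :=
  (exteriorPower.ιMulti A 2 (M := Ω[A⁄k])).map_eq_zero_of_eq ![ω, ω]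
    (i := 0) (j := 1) (by simp) (by decide)

lemma wedge_swap (ω η : Ω[A⁄k]) : wedge η ω = - wedge ω η := by
  have h := (exteriorPower.ιMulti A 2 (M := Ω[A⁄k])).map_swap ![ω, η]
    (i := 0) (j := 1) (by decide)
  have h2 : (![ω, η] ∘ (Equiv.swap (0 : Fin 2) 1)) = ![η, ω] := by
    funext i; fin_cases i <;> simp
  rw [h2] at h
  exact h

lemma wedge_add_right (ω η η' : Ω[A⁄k]) : wedge ω (η + η') = wedge ω η + wedge ω η' := by
  rw [wedge_swap, wedge_add_left, wedge_swap ω η, wedge_swap ω η']; abel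

lemma wedge_smul_right (f : A) (ω η : Ω[A⁄k]) : wedge ω (f • η) = f • wedge ω η := by
  rw [wedge_swap, wedge_smul_left, wedge_swap ω η]; simp

lemma wedge_zero_right (ω : Ω[A⁄k]) : wedge ω 0 = 0 := by
  simpa using wedge_smul_right (0 : A) ω 0

lemma wedge_zero_left (ω : Ω[A⁄k]) : wedge 0 ω = 0 := by
  simpa using wedge_smul_left (0 : A) 0 ω

variable (k A)

/-- The additive map on the free `A`-module on symbols `[g]` sending `f • [g]` to `df ∧ dg`. -/
def preExtDeriv : (A →₀ A) →+ ⋀[A]^2 Ω[A⁄k] :=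
  Finsupp.liftAddHom fun g =>
    { toFun := fun f => wedge (KaehlerDifferential.D k A f) (KaehlerDifferential.D k A g)
      map_zero' := by rw [map_zero, wedge_zero_left]
      map_add' := fun f f' => by rw [map_add, wedge_add_left] }

lemma preExtDeriv_single (f g : A) : preExtDeriv k A (Finsupp.single g f) =
    wedge (KaehlerDifferential.D k A f) (KaehlerDifferential.D k A g) := by
  rw [preExtDeriv, Finsupp.liftAddHom_apply_single]
  rfl

lemma preExtDeriv_kerTotal (x : A →₀ A) (hx : x ∈ KaehlerDifferential.kerTotal k A) :
    preExtDeriv k A x = 0 := by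
  suffices h : ∀ f : A, preExtDeriv k A (f • x) = 0 by simpa using h 1
  unfold KaehlerDifferential.kerTotal at hx
  induction hx using Submodule.span_induction with
  | mem x hx =>
    intro f
    rcases hx with (⟨⟨a, b⟩, rfl⟩ | ⟨⟨a, b⟩, rfl⟩) | ⟨c, rfl⟩
    · simp only [smul_sub, smul_add, Finsupp.smul_single, map_sub, map_add, preExtDeriv_single,
        wedge_add_right, sub_self]
    · simp only [smul_sub, smul_add, Finsupp.smul_single, map_sub, map_add, preExtDeriv_single,
        wedge_add_right, smul_eq_mul, mul_one, Derivation.leibniz, wedge_smul_right,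
        wedge_add_left, wedge_smul_left]
      rw [wedge_swap (KaehlerDifferential.D k A a) (KaehlerDifferential.D k A b)]
      simp only [smul_neg]
      abel
    · simp only [Finsupp.smul_single, preExtDeriv_single, Derivation.map_algebraMap,
        wedge_zero_right]
  | zero => intro f; simp
  | add x y _ _ hx hy => intro f; rw [smul_add, map_add, hx, hy, add_zero]
  | smul a x _ hx => intro f; rw [smul_smul]; exact hx _

/-- The exterior derivative `d : Ω → Ω²` on Kähler 1-forms, `d(f dg) = df ∧ dg`. -/
def extDeriv : Ω[A⁄k] →+ ⋀[A]^2 Ω[A⁄k] :=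
  (QuotientAddGroup.lift (KaehlerDifferential.kerTotal k A).toAddSubgroup (preExtDeriv k A)
    (preExtDeriv_kerTotal k A)).comp
    (KaehlerDifferential.quotKerTotalEquiv k A).symm.toLinearMap.toAddMonoidHom

variable {A}

lemma extDeriv_smul_D (f g : A) : extDeriv k A (f • KaehlerDifferential.D k A g) =
    wedge (KaehlerDifferential.D k A f) (KaehlerDifferential.D k A g) := by
  have h : (KaehlerDifferential.quotKerTotalEquiv k A).symm (f • KaehlerDifferential.D k A g)
      = (KaehlerDifferential.kerTotal k A).mkQ (Finsupp.single g f) := by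
    rw [LinearEquiv.symm_apply_eq]
    change _ = Finsupp.linearCombination A (KaehlerDifferential.D k A) (Finsupp.single g f)
    simp
  calc extDeriv k A (f • KaehlerDifferential.D k A g)
      = QuotientAddGroup.lift (KaehlerDifferential.kerTotal k A).toAddSubgroup (preExtDeriv k A)
          (preExtDeriv_kerTotal k A) ((KaehlerDifferential.quotKerTotalEquiv k A).symm
            (f • KaehlerDifferential.D k A g)) := rfl
    _ = preExtDeriv k A (Finsupp.single g f) := by rw [h]; rfl
    _ = _ := preExtDeriv_single k A f g

variable {k}

/-- A matrix-valued 1-form `α` is flat if `dα + α ∧ α = 0`, where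
`(α ∧ α)ᵢⱼ = ∑ₛ αᵢₛ ∧ αₛⱼ`. -/
def IsFlat {n : ℕ} (α : Matrix (Fin n) (Fin n) Ω[A⁄k]) : Prop :=
  ∀ i j, extDeriv k A (α i j) + ∑ s, wedge (α i s) (α s j) = 0

/-- The value `α(v) ∈ Mₙ(A)` of a matrix-valued 1-form on a vector field. -/
def evalForm {n : ℕ} (α : Matrix (Fin n) (Fin n) Ω[A⁄k]) (v : Derivation k A A) :
    Matrix (Fin n) (Fin n) A :=
  α.map v.liftKaehlerDifferential

/-- The map `Ω_A → Ω_B` induced by an algebra homomorphism `φ : A → B`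
(`f dg ↦ φ(f) dφ(g)`). -/
def pullbackForm {B : Type*} [CommRing B] [Algebra k B] (φ : A →ₐ[k] B) (ω : Ω[A⁄k]) : Ω[B⁄k] :=
  letI := φ.toRingHom.toAlgebra
  haveI : IsScalarTower k A B := IsScalarTower.of_algebraMap_eq' φ.comp_algebraMap.symm
  KaehlerDifferential.map k k A B ω

lemma pullbackForm_smul_D {B : Type*} [CommRing B] [Algebra k B] (φ : A →ₐ[k] B) (f g : A) :
    pullbackForm φ (f • KaehlerDifferential.D k A g) =
      φ f • KaehlerDifferential.D k B (φ g) := by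
  let _ := φ.toRingHom.toAlgebra
  have : IsScalarTower k A B := IsScalarTower.of_algebraMap_eq' φ.comp_algebraMap.symm
  change KaehlerDifferential.map k k A B _ = _
  rw [map_smul, KaehlerDifferential.map_D, ← algebraMap_smul B f]
  rfl

lemma pullbackForm_add {B : Type*} [CommRing B] [Algebra k B] (φ : A →ₐ[k] B) (ω η : Ω[A⁄k]) :
    pullbackForm φ (ω + η) = pullbackForm φ ω + pullbackForm φ η := by
  let _ := φ.toRingHom.toAlgebra
  have : IsScalarTower k A B := IsScalarTower.of_algebraMap_eq' φ.comp_algebraMap.symm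
  exact map_add (KaehlerDifferential.map k k A B) ω η

end Forms

/-! ### The algebraic torus -/

section Torus

/-- The torus `T = (ℂ*)ˡ` (its group of complex points). -/
abbrev Torus (l : ℕ) : Type := Fin l → ℂˣ

/-- The coordinate ring `ℂ[T] = ℂ[t₁^±, …, t_l^±]`, the Laurent polynomials in `l` variables;
the monomial `t^m` is `single m 1`. -/
abbrev CoordRing (l : ℕ) : Type := AddMonoidAlgebra ℂ (Fin l → ℤ)

variable {l : ℕ}

/-- The value `t^m = ∏ᵢ tᵢ^{mᵢ}` of the monomial with exponent `m` at `t ∈ T`. -/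
def monomialValue (t : Torus l) (m : Fin l → ℤ) : ℂ := ((∏ i, t i ^ m i : ℂˣ) : ℂ)

lemma monomialValue_zero (t : Torus l) : monomialValue t 0 = 1 := by simp [monomialValue]

lemma monomialValue_add (t : Torus l) (m m' : Fin l → ℤ) :
    monomialValue t (m + m') = monomialValue t m * monomialValue t m' := by
  simp [monomialValue, zpow_add, Finset.prod_mul_distrib]

lemma monomialValue_mul (s t : Torus l) (m : Fin l → ℤ) :
    monomialValue (s * t) m = monomialValue s m * monomialValue t m := by
  simp [monomialValue, mul_zpow, Finset.prod_mul_distrib]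

/-- Evaluation of a regular function at a point of the torus. -/
def evalAt (t : Torus l) : CoordRing l →ₐ[ℂ] ℂ :=
  AddMonoidAlgebra.lift ℂ ℂ (Fin l → ℤ)
    { toFun := fun m => monomialValue t m.toAdd
      map_one' := monomialValue_zero t
      map_mul' := fun m m' => monomialValue_add t m.toAdd m'.toAdd }

/-- Translation of regular functions by `t ∈ T`: the algebra homomorphism `f ↦ f(t · -)`,
that is `t^m ↦ (value of t^m at t) t^m`. -/
def translate (t : Torus l) : CoordRing l →ₐ[ℂ] CoordRing l :=
  AddMonoidAlgebra.lift ℂ (CoordRing l) (Fin l → ℤ)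
    { toFun := fun m => AddMonoidAlgebra.single m.toAdd (monomialValue t m.toAdd)
      map_one' := by rw [toAdd_one, monomialValue_zero]; rfl
      map_mul' := fun m m' => by
        rw [toAdd_mul, monomialValue_add, AddMonoidAlgebra.single_mul_single] }

lemma translate_single (t : Torus l) (m : Fin l → ℤ) (c : ℂ) :
    translate t (AddMonoidAlgebra.single m c) = AddMonoidAlgebra.single m (c * monomialValue t m) := by
  simp [translate]

lemma evalAt_single (t : Torus l) (m : Fin l → ℤ) (c : ℂ) :
    evalAt t (AddMonoidAlgebra.single m c) = c * monomialValue t m := by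
  simp [evalAt]

lemma evalAt_translate (s t : Torus l) (f : CoordRing l) :
    evalAt s (translate t f) = evalAt (t * s) f := by
  induction f using AddMonoidAlgebra.induction_linear with
  | zero => simp
  | add f g hf hg => simp [hf, hg]
  | single m c => rw [translate_single, evalAt_single, evalAt_single, monomialValue_mul, mul_assoc]

variable (l)

/-- The Lie algebra of the torus: the translation-invariant vector fields on `T`, a Lie subalgebra
of the Lie algebra `Der_ℂ(ℂ[T])` of all vector fields. -/
def lieTorus : LieSubalgebra ℂ (Derivation ℂ (CoordRing l) (CoordRing l)) where
  carrier := {v | ∀ (t : Torus l) (f : CoordRing l), v (translate t f) = translate t (v f)}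
  add_mem' := by
    intro v w hv hw t f
    simp [hv t f, hw t f]
  zero_mem' := by intro t f; simp
  smul_mem' := by
    intro c v hv t f
    simp [hv t f]
  lie_mem' := by
    intro v w hv hw t f
    simp [Derivation.commutator_apply, hv t, hw t]

variable {l}

/-- The `ℂ`-linear map `t^m ↦ mᵢ t^m` on the coordinate ring. -/
def eulerMap (i : Fin l) : CoordRing l →ₗ[ℂ] CoordRing l :=
  (Finsupp.lsum ℂ fun m : Fin l → ℤ =>
    (((m i : ℤ) : ℂ) • LinearMap.toSpanSingleton ℂ (CoordRing l) (AddMonoidAlgebra.single m 1))).comp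
    (AddMonoidAlgebra.coeffLinearEquiv ℂ).toLinearMap

lemma eulerMap_single (i : Fin l) (m : Fin l → ℤ) (c : ℂ) :
    eulerMap i (AddMonoidAlgebra.single m c) = AddMonoidAlgebra.single m (m i * c) := by
  simp [eulerMap]

/-- The vector field `tᵢ ∂/∂tᵢ` on the torus, `t^m ↦ mᵢ t^m`. -/
def eulerDer (i : Fin l) : Derivation ℂ (CoordRing l) (CoordRing l) :=
  Derivation.mk' (eulerMap i) (by
    intro f g
    induction f using AddMonoidAlgebra.induction_linear with
    | zero => simp
    | add f f' hf hf' => simp only [add_mul, map_add, hf, hf', add_smul, smul_add]; abel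
    | single m c =>
      induction g using AddMonoidAlgebra.induction_linear with
      | zero => simp
      | add g g' hg hg' => simp only [mul_add, map_add, hg, hg', add_smul, smul_add]; abel
      | single m' c' =>
        simp only [smul_eq_mul, AddMonoidAlgebra.single_mul_single, eulerMap_single]
        rw [add_comm m' m, ← AddMonoidAlgebra.single_add]
        congr 1
        simp only [Pi.add_apply, Int.cast_add]
        ring)

lemma eulerDer_single (i : Fin l) (m : Fin l → ℤ) (c : ℂ) :
    eulerDer i (AddMonoidAlgebra.single m c) = AddMonoidAlgebra.single m (m i * c) := eulerMap_single i m c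

/-- The standard basis vectors `tᵢ ∂/∂tᵢ` of `Lie T`. -/
def eulerLie (i : Fin l) : lieTorus l :=
  ⟨eulerDer i, by
    intro t f
    induction f using AddMonoidAlgebra.induction_linear with
    | zero => simp
    | add f g hf hg => simp only [map_add, hf, hg]
    | single m c => rw [translate_single, eulerDer_single, eulerDer_single, translate_single,
        mul_assoc]⟩

lemma eulerLie_lie (i j : Fin l) : ⁅eulerLie i, eulerLie j⁆ = 0 := by
  apply Subtype.ext
  apply Derivation.ext
  intro f
  change ⁅eulerDer i, eulerDer j⁆ f = 0
  rw [Derivation.commutator_apply, sub_eq_zero]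
  induction f using AddMonoidAlgebra.induction_linear with
  | zero => simp
  | add f g hf hg => simp only [map_add, hf, hg]
  | single m c =>
    simp only [eulerDer_single]
    congr 1
    ring

end Torus

/-! ### Invariant D-modules on the torus -/

/- The Lie bracket on matrices is the commutator. -/
attribute [local instance] LieRing.ofAssociativeRing

section InvariantModules

/-- An invariant `D(T)`-module `𝕄_α` of rank `n` on `T = (ℂ*)ˡ`: a flat translation-invariant
matrix-valued 1-form `α`, together with the `D(T)`-module structure on `ℂ[T]ⁿ` (given by its action
map) which extends the `ℂ[T]`-module structure and satisfies
`v (e₁, …, eₙ) = (e₁, …, eₙ) α(v)` for every vector field `v`. -/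
structure InvariantDModule (l n : ℕ) where
  /-- the connection form `α` -/
  form : Matrix (Fin n) (Fin n) Ω[CoordRing l⁄ℂ]
  flat : IsFlat form
  invariant : ∀ t : Torus l, form.map (pullbackForm (translate t)) = form
  /-- the action of `D(T)` on `ℂ[T]ⁿ` -/
  action : diffOps ℂ (CoordRing l) →+* Module.End ℂ (Fin n → CoordRing l)
  action_funOp : ∀ (f : CoordRing l) (s : Fin n → CoordRing l), action (funOp ℂ f) s = f • s
  action_derOp : ∀ (v : Derivation ℂ (CoordRing l) (CoordRing l)) (j : Fin n),
    action (derOp v) (Pi.single j 1) = fun i => evalForm form v i j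

namespace InvariantDModule

variable {l n : ℕ}

/-- The underlying space `ℂ[T]ⁿ` of an invariant D-module. -/
def Carrier (_M : InvariantDModule l n) : Type := Fin n → CoordRing l

instance (M : InvariantDModule l n) : AddCommGroup M.Carrier :=
  inferInstanceAs (AddCommGroup (Fin n → CoordRing l))

instance (M : InvariantDModule l n) : Module ℂ M.Carrier :=
  inferInstanceAs (Module ℂ (Fin n → CoordRing l))

/-- The `D(T)`-module structure of an invariant D-module. -/
instance (M : InvariantDModule l n) : Module (diffOps ℂ (CoordRing l)) M.Carrier :=
  Module.compHom M.Carrier (R := Module.End ℂ M.Carrier) M.action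

lemma smul_def (M : InvariantDModule l n) (P : diffOps ℂ (CoordRing l)) (s : M.Carrier) :
    P • s = M.action P s := rfl

variable (l n)

/-- Isomorphism of `D(T)`-modules, as an equivalence relation on invariant D-modules. -/
def isoSetoid : Setoid (InvariantDModule l n) where
  r M N := Nonempty (M.Carrier ≃ₗ[diffOps ℂ (CoordRing l)] N.Carrier)
  iseqv :=
    { refl := fun _ => ⟨LinearEquiv.refl _ _⟩
      symm := fun ⟨e⟩ => ⟨e.symm⟩
      trans := fun ⟨e⟩ ⟨e'⟩ => ⟨e.trans e'⟩ }

end InvariantDModule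

/-- The set of isomorphism classes of invariant D-modules of rank `n` on `(ℂ*)ˡ`. -/
def InvariantDModuleClasses (l n : ℕ) : Type := Quotient (InvariantDModule.isoSetoid l n)

/-- The isomorphism class of an invariant D-module. -/
def InvariantDModule.isoClass {l n : ℕ} (M : InvariantDModule l n) : InvariantDModuleClasses l n :=
  Quotient.mk (InvariantDModule.isoSetoid l n) M

/-- The set `Hom_Lie(Lie T, gl_n(ℂ))` of `n`-dimensional representations of `Lie T`. -/
abbrev LieRep (l n : ℕ) : Type := lieTorus l →ₗ⁅ℂ⁆ Matrix (Fin n) (Fin n) ℂ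

/-- The 1-form `α` is the invariant form attached to the representation `ρ`: for every
invariant vector field `v`, the matrix `α(v)` is the constant matrix `ρ(v)`. -/
def IsFormOf {l n : ℕ} (α : Matrix (Fin n) (Fin n) Ω[CoordRing l⁄ℂ]) (ρ : LieRep l n) : Prop :=
  ∀ v : lieTorus l, evalForm α v.1 = (ρ v).map (algebraMap ℂ (CoordRing l))

end InvariantModules

/-! ### Commuting tuples and the exponential map -/

section Commuting

/-- `C_l(GL_n(ℂ))`: commuting `l`-tuples of invertible `n × n` matrices. -/
def CommTuples (l n : ℕ) : Type :=
  {B : Fin l → GL (Fin n) ℂ // ∀ i j, Commute (B i) (B j)}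

/-- Simultaneous conjugation on commuting tuples. -/
def conjSetoid (l n : ℕ) : Setoid (CommTuples l n) where
  r B C := ∃ g : GL (Fin n) ℂ, ∀ i, C.1 i = g * B.1 i * g⁻¹
  iseqv :=
    { refl := fun _ => ⟨1, fun i => by simp⟩
      symm := fun ⟨g, h⟩ => ⟨g⁻¹, fun i => by rw [h i]; group⟩
      trans := fun ⟨g, h⟩ ⟨g', h'⟩ => ⟨g' * g, fun i => by rw [h' i, h i]; group⟩ }

/-- `C_l(GL_n(ℂ))/GL_n(ℂ)`: commuting tuples up to simultaneous conjugation. -/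
def CommTupleClasses (l n : ℕ) : Type := Quotient (conjSetoid l n)

/-- The exponential of a complex matrix, as an element of `GL_n(ℂ)`. -/
def expGL {n : ℕ} (A : Matrix (Fin n) (Fin n) ℂ) : GL (Fin n) ℂ := (Matrix.isUnit_exp A).unit

lemma expGL_commute {n : ℕ} {A B : Matrix (Fin n) (Fin n) ℂ} (h : Commute A B) :
    Commute (expGL A) (expGL B) := Units.ext (Commute.exp h).eq

/-- The commuting tuple `(exp(2πi ρ(t₁∂/∂t₁)), …, exp(2πi ρ(t_l∂/∂t_l)))`. -/
def expTuple {l n : ℕ} (ρ : LieRep l n) : CommTuples l n :=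
  ⟨fun i => expGL ((2 * (Real.pi : ℂ) * Complex.I) • ρ (eulerLie i)), fun i j => by
    apply expGL_commute
    have h : ⁅ρ (eulerLie i), ρ (eulerLie j)⁆ = 0 := by rw [← LieHom.map_lie, eulerLie_lie, map_zero]
    rw [Ring.lie_def, sub_eq_zero] at h
    exact (Commute.smul_left (show Commute _ _ from h) _).smul_right _⟩

/-- The exponential map `Exp : Hom_Lie(Lie T, gl_n(ℂ)) → C_l(GL_n(ℂ))/GL_n(ℂ)`. -/
def Exp {l n : ℕ} (ρ : LieRep l n) : CommTupleClasses l n :=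
  Quotient.mk (conjSetoid l n) (expTuple ρ)

end Commuting

end InvDMod

end

/-! An invariant 1-form has constant coefficients in the basis dt_k/t_k, so a form that comes with a
D(T)-action is ∑ A_k dt_k/t_k with A_k = ρ(θ_k). The A_k commute because the θ_k do. Conversely, a
commuting family gives a flat form, and θ_k ↦ θ_k + A_k must extend to all of D(T). For this, D(T)
is generated by functions and Euler operators (`mem_eulerSubring_of_mem_diffOps`, a Newton expansion
in θ_j). Every relation among these generators lifts: the degree κ part of an operator is t^m ↦ p(m)
t^(m+κ) with p a polynomial, its lift is t^m u ↦ t^(m+κ) p(m+A) u, and a polynomial vanishing on ℤ^l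
is zero (`eq_zero_of_mem_pairSubring`, `exists_action`).

An isomorphism of D(T)-modules is an invertible matrix G of Laurent polynomials with θ_k G + B_k G =
G A_k, a gauge transformation. The claim thus becomes `Exp_eq_iff_gaugeEquiv`. Given G, its
coefficient G_m satisfies (m_k + B_k) G_m = G_m A_k. Exponentiating removes the integer m_k, so G
intertwines exp(2πi A_k) and exp(2πi B_k) (`IsGauge.exp`), and G(1) conjugates one tuple to the
other.

Conversely, after a constant conjugation the exponentials agree. Each exp(2πi A_k) has a logarithm
2πi R_k with R_k in its bicommutant (`exists_two_pi_I_log`), so the R_k commute with each other and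
with all A_j. Then D = A_k - R_k satisfies exp(2πi D) = 1, hence is diagonalizable with integer
eigenvalues (`exists_integral_spectral_decomposition`), and t_k^D is a Laurent polynomial gauge
transformation replacing A_k by R_k (`GaugeEquiv.sub`). As R depends only on the exponentials, A and
B are both gauge equivalent to R. Bicommutant logarithms also give surjectivity. -/

noncomputable section

namespace InvDMod

attribute [local instance] LieRing.ofAssociativeRing

/-! ### Matrices with trivial exponential are diagonalizable with integer eigenvalues. -/

section MatrixExp

open Matrix

attribute [local instance] Matrix.linftyOpNormedRing Matrix.linftyOpNormedAlgebra

variable {n : ℕ}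

lemma exp_smul_one (c : ℂ) :
    NormedSpace.exp (c • (1 : Matrix (Fin n) (Fin n) ℂ)) = Complex.exp c • 1 := by
  rw [smul_one_eq_diagonal, Matrix.exp_diagonal, smul_one_eq_diagonal]
  congr 1
  ext i
  rw [Pi.coe_exp, Complex.exp_eq_exp_ℂ]

/-- The exponential preserves intertwining relations. -/
lemma exp_mul_eq_mul_exp {X Y W : Matrix (Fin n) (Fin n) ℂ} (h : X * W = W * Y) :
    NormedSpace.exp X * W = W * NormedSpace.exp Y := by
  have hX : HasSum (fun k : ℕ => ((k.factorial : ℂ)⁻¹ • X ^ k) * W) (NormedSpace.exp X * W) :=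
    (NormedSpace.exp_series_hasSum_exp' (𝕂 := ℂ) X).mul_right W
  have hY : HasSum (fun k : ℕ => W * ((k.factorial : ℂ)⁻¹ • Y ^ k)) (W * NormedSpace.exp Y) :=
    (NormedSpace.exp_series_hasSum_exp' (𝕂 := ℂ) Y).mul_left W
  refine hX.unique (hY.congr_fun fun k => ?_)
  have hk : X ^ k * W = W * Y ^ k := (SemiconjBy.pow_right (a := W) (show W * Y = X * W from h.symm) k).symm
  rw [smul_mul_assoc, mul_smul_comm, hk]

/-- The exponential acts on a vector block killed by `(D - μ)²` as its first order Taylor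
polynomial. -/
lemma exp_mul_of_sq_mul_eq_zero (D u : Matrix (Fin n) (Fin n) ℂ) (c μ : ℂ)
    (h : (D - scalar (Fin n) μ) * ((D - scalar (Fin n) μ) * u) = 0) :
    NormedSpace.exp (c • D) * u =
      Complex.exp (c * μ) • (u + c • ((D - scalar (Fin n) μ) * u)) := by
  set N := D - scalar (Fin n) μ with hN
  have hD : c • D = (c * μ) • (1 : Matrix (Fin n) (Fin n) ℂ) + c • N := by
    rw [hN, smul_sub, scalar_apply, ← smul_one_eq_diagonal, smul_smul]; abel
  have hcomm : Commute ((c * μ) • (1 : Matrix (Fin n) (Fin n) ℂ)) (c • N) :=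
    (Commute.one_left _).smul_left _
  have hs : HasSum (fun k : ℕ => ((k.factorial : ℂ)⁻¹ • (c • N) ^ k) * u)
      (NormedSpace.exp (c • N) * u) :=
    (NormedSpace.exp_series_hasSum_exp' (𝕂 := ℂ) (c • N)).mul_right u
  have h2 : HasSum (fun k : ℕ => ((k.factorial : ℂ)⁻¹ • (c • N) ^ k) * u)
      (∑ k ∈ Finset.range 2, ((k.factorial : ℂ)⁻¹ • (c • N) ^ k) * u) := by
    apply hasSum_sum_of_ne_finset_zero
    intro k hk
    obtain ⟨j, rfl⟩ : ∃ j, k = j + 2 := ⟨k - 2, by simp at hk; omega⟩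
    rw [smul_pow, smul_smul, smul_mul_assoc, pow_add N, pow_two N, mul_assoc, mul_assoc, h]
    simp
  rw [hD, Matrix.exp_add_of_commute _ _ hcomm, exp_smul_one, mul_assoc, hs.unique h2]
  simp [Finset.sum_range_succ]

/-- If `exp (c D) = 1` with `c ≠ 0`, then the roots of the minimal polynomial of `D` are simple. -/
lemma minpoly_roots_nodup {D : Matrix (Fin n) (Fin n) ℂ} {c : ℂ} (hc : c ≠ 0)
    (h : NormedSpace.exp (c • D) = 1) : (minpoly ℂ D).roots.Nodup := by
  have hint : IsIntegral ℂ D := Matrix.isIntegral D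
  rw [Multiset.nodup_iff_count_le_one]
  intro μ
  rw [Polynomial.count_roots]
  by_contra! hlt
  obtain ⟨q, hq⟩ := (Polynomial.le_rootMultiplicity_iff (minpoly.ne_zero hint)).1 hlt
  have hX : Polynomial.aeval D (Polynomial.X - Polynomial.C μ) = D - scalar (Fin n) μ := by
    simp [algebraMap_eq_diagonal, scalar_apply, Pi.algebraMap_def]
  have h0 : (D - scalar (Fin n) μ) * ((D - scalar (Fin n) μ) * Polynomial.aeval D q) = 0 := by
    rw [← hX, ← mul_assoc, ← map_mul, ← map_mul, ← pow_two, ← hq, minpoly.aeval]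
  have h1 := exp_mul_of_sq_mul_eq_zero D _ c μ h0
  -- With u = q(D) and N = D - μ, `h1` reads u = e^(cμ)(u + cNu). Multiplying by N gives Nu =
  -- e^(cμ)Nu. If Nu ≠ 0 then e^(cμ) = 1, and `h1` itself leaves cNu = 0, a contradiction.
  have hmul : (D - scalar (Fin n) μ) * Polynomial.aeval D q = 0 := by
    have h2 := congrArg ((D - scalar (Fin n) μ) * ·) h1
    simp only [h, one_mul, mul_smul_comm, mul_add, h0, smul_zero, add_zero] at h2
    rw [h, one_mul] at h1
    rw [smul_add, smul_smul] at h1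
    by_contra hne
    have he : Complex.exp (c * μ) = 1 := by
      by_contra hne1
      apply hne
      have : (1 - Complex.exp (c * μ)) • ((D - scalar (Fin n) μ) * Polynomial.aeval D q) = 0 := by
        rw [sub_smul, one_smul, ← h2, sub_self]
      exact (smul_eq_zero.1 this).resolve_left (sub_ne_zero.2 (Ne.symm hne1))
    rw [he, one_smul, one_mul] at h1
    have h3 := left_eq_add.1 h1
    exact hne ((smul_eq_zero.1 h3).resolve_left hc)
  -- Now (X - μ)q annihilates D but has degree one less than the minimal polynomial.
  rw [← hX, ← map_mul] at hmul
  have hdvd := minpoly.dvd ℂ D hmul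
  have hne : (Polynomial.X - Polynomial.C μ) * q ≠ 0 := by
    intro h0
    apply minpoly.ne_zero hint
    rw [hq, pow_two, mul_assoc, h0, mul_zero]
  have := Polynomial.natDegree_le_of_dvd hdvd hne
  rw [hq, pow_two, mul_assoc, Polynomial.natDegree_mul (Polynomial.X_sub_C_ne_zero μ) hne] at this
  simp at this

/-- If `exp (c D) = 1`, then `exp (c μ) = 1` for every root `μ` of the minimal polynomial of `D`. -/
lemma exp_eq_one_of_mem_roots_minpoly {D : Matrix (Fin n) (Fin n) ℂ} {c : ℂ}
    (h : NormedSpace.exp (c • D) = 1) {μ : ℂ} (hμ : μ ∈ (minpoly ℂ D).roots) :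
    Complex.exp (c * μ) = 1 := by
  have hint : IsIntegral ℂ D := Matrix.isIntegral D
  obtain ⟨q, hq⟩ := Polynomial.dvd_iff_isRoot.2 (Polynomial.isRoot_of_mem_roots hμ)
  have hX : Polynomial.aeval D (Polynomial.X - Polynomial.C μ) = D - scalar (Fin n) μ := by
    simp [algebraMap_eq_diagonal, scalar_apply, Pi.algebraMap_def]
  have h0 : (D - scalar (Fin n) μ) * Polynomial.aeval D q = 0 := by
    rw [← hX, ← map_mul, ← hq, minpoly.aeval]
  have h1 := exp_mul_of_sq_mul_eq_zero D (Polynomial.aeval D q) c μ (by rw [h0, mul_zero])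
  rw [h, one_mul, h0, smul_zero, add_zero] at h1
  have hne : Polynomial.aeval D q ≠ 0 := by
    intro h0
    have hq0 : q ≠ 0 := by
      rintro rfl
      exact minpoly.ne_zero hint (by rw [hq, mul_zero])
    have := Polynomial.natDegree_le_of_dvd (minpoly.dvd ℂ D h0) hq0
    rw [hq, Polynomial.natDegree_mul (Polynomial.X_sub_C_ne_zero μ) hq0] at this
    simp at this
  by_contra hne1
  have : (1 - Complex.exp (c * μ)) • Polynomial.aeval D q = 0 := by
    rw [sub_smul, one_smul, ← h1, sub_self]
  exact (smul_eq_zero.1 this).elim (sub_ne_zero.2 (Ne.symm hne1)) hne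

/-- A matrix `D` with `exp (2πi D) = 1` is diagonalizable with integer eigenvalues: it has a
spectral decomposition by projections which are polynomials in `D`. -/
lemma exists_integral_spectral_decomposition {D : Matrix (Fin n) (Fin n) ℂ}
    (h : NormedSpace.exp ((2 * (Real.pi : ℂ) * Complex.I) • D) = 1) :
    ∃ (F : Finset ℤ) (p : ℤ → Matrix (Fin n) (Fin n) ℂ),
      (∑ m ∈ F, p m = 1) ∧ (∀ m ∈ F, D * p m = (m : ℂ) • p m) ∧
      (∀ m C, Commute C D → Commute C (p m)) ∧
      (∀ m ∈ F, ∀ m' ∈ F, m ≠ m' → p m * p m' = 0) := by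
  have hc := Complex.two_pi_I_ne_zero
  have hint : IsIntegral ℂ D := Matrix.isIntegral D
  set q := minpoly ℂ D with hq
  have hroots : ∀ μ ∈ q.roots, ∃ m : ℤ, μ = m := by
    intro μ hμ
    obtain ⟨m, hm⟩ := Complex.exp_eq_one_iff.1 (exp_eq_one_of_mem_roots_minpoly h hμ)
    refine ⟨m, mul_left_cancel₀ hc ?_⟩
    rw [hm]; ring
  set F : Finset ℤ := q.roots.toFinset.preimage (fun m : ℤ => (m : ℂ))
    (Int.cast_injective.injOn) with hF
  have hinj : Set.InjOn (fun m : ℤ => (m : ℂ)) F := Int.cast_injective.injOn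
  have himg : F.image (fun m : ℤ => (m : ℂ)) = q.roots.toFinset := by
    ext μ
    simp only [hF, Finset.mem_image, Finset.mem_preimage]
    constructor
    · rintro ⟨m, hm, rfl⟩; exact hm
    · intro hμ
      obtain ⟨m, rfl⟩ := hroots μ (Multiset.mem_toFinset.1 hμ)
      exact ⟨m, hμ, rfl⟩
  -- Simple integer roots make the minimal polynomial ∏ (X - m) over F, so Lagrange interpolation at
  -- F, evaluated at D, yields the spectral projections.
  have hnodal : Lagrange.nodal F (fun m : ℤ => (m : ℂ)) = q := by
    have h1 := (IsAlgClosed.splits q).eq_prod_roots_of_monic (minpoly.monic hint)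
    rw [h1, Lagrange.nodal_eq,
      ← Finset.prod_image (f := fun μ : ℂ => Polynomial.X - Polynomial.C μ)
        (fun a _ b _ hab => Int.cast_injective hab), himg, Finset.prod,
      Multiset.toFinset_val, Multiset.dedup_eq_self.2 (minpoly_roots_nodup hc h)]
  set p : ℤ → Matrix (Fin n) (Fin n) ℂ := fun m =>
    Polynomial.aeval D (Lagrange.basis F (fun m : ℤ => (m : ℂ)) m) with hp
  have hDp : ∀ m ∈ F, D * p m = (m : ℂ) • p m := by
    intro m hm
    have h1 : (Polynomial.X - Polynomial.C (m : ℂ)) * Lagrange.basis F (fun m : ℤ => (m : ℂ)) m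
        = Polynomial.C (∏ j ∈ F.erase m, ((m : ℂ) - j)⁻¹) * q := by
      rw [← hnodal, Lagrange.nodal_eq_mul_nodal_erase hm, Lagrange.nodal_eq, Lagrange.basis,
        map_prod, mul_left_comm, ← Finset.prod_mul_distrib]
      rfl
    have h2 := congrArg (Polynomial.aeval D) h1
    rw [map_mul, map_mul, hq, minpoly.aeval, mul_zero, map_sub, sub_mul, sub_eq_zero] at h2
    simpa [Algebra.smul_def] using h2
  have hcomm : ∀ m C, Commute C D → Commute C (p m) := by
    intro m C hC
    change C * _ = _ * C
    have h1 : Polynomial.aeval D (Lagrange.basis F (fun m : ℤ => (m : ℂ)) m) ∈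
        Subalgebra.centralizer ℂ ({C} : Set (Matrix (Fin n) (Fin n) ℂ)) := by
      refine Algebra.adjoin_le ?_ (Polynomial.aeval_mem_adjoin_singleton ℂ D)
      simpa [Subalgebra.mem_centralizer_iff, Set.mem_centralizer_iff] using hC.eq
    exact (Subalgebra.mem_centralizer_iff ℂ).1 h1 C rfl
  refine ⟨F, p, ?_, hDp, hcomm, ?_⟩
  -- With no eigenvalues the minimal polynomial is 1, so 1 = 0 in the matrix algebra and the empty
  -- sum is still 1.
  · rcases F.eq_empty_or_nonempty with hemp | hne
    · have : q = 1 := by rw [← hnodal, hemp, Lagrange.nodal_empty]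
      have h1 : Polynomial.aeval D q = 0 := minpoly.aeval ℂ D
      rw [this, map_one] at h1
      rw [hemp, Finset.sum_empty, h1]
    · rw [hp, ← map_sum, Lagrange.sum_basis hinj hne, map_one]
  · intro m hm m' hm' hne
    -- D multiplies the product by m when applied on the left, and by m' after being moved past the
    -- first factor.
    have h1 : (m : ℂ) • (p m * p m') = (m' : ℂ) • (p m * p m') := by
      rw [← smul_mul_assoc, ← hDp m hm, ← mul_smul_comm, ← hDp m' hm', ← mul_assoc,
        (hcomm m D (Commute.refl D)).eq]
    rw [← sub_eq_zero, ← sub_smul] at h1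
    exact (smul_eq_zero.1 h1).resolve_left (sub_ne_zero.2 (Int.cast_injective.ne hne))

end MatrixExp

/-! ### Logarithms in the bicommutant. -/

section Log

/-- In a complete normed algebra every element close to `1` is an exponential. -/
lemma eventually_exists_exp_eq {B : Type*} [NormedRing B] [NormedAlgebra ℂ B] [CompleteSpace B] :
    ∀ᶠ b in nhds (1 : B), ∃ x : B, NormedSpace.exp x = b := by
  -- The derivative at 0 is the identity, so exp maps the neighbourhood filter of 0 onto that of 1.
  have hd : HasStrictFDerivAt NormedSpace.exp (1 : B →L[ℂ] B) (0 : B) := hasStrictFDerivAt_exp_zero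
  have h := hd.map_nhds_eq_of_surj (LinearMap.range_eq_top.2 fun x => ⟨x, rfl⟩)
  rw [NormedSpace.exp_zero] at h
  rw [← h]
  exact Filter.eventually_map.2 (Filter.Eventually.of_forall fun x => ⟨x, rfl⟩)

/-- In a finite dimensional algebra, an element which is joined to `1` by a complex line of
generically invertible elements has a logarithm in its bicommutant. -/
lemma exists_log_of_isPreconnected {A : Type*} [NormedRing A] [NormedAlgebra ℂ A]
    [FiniteDimensional ℂ A] {E : A} (hE : IsUnit E)
    (hU : IsPreconnected {z : ℂ | IsUnit (1 + z • (E - 1))}) :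
    ∃ R : A, NormedSpace.exp R = E ∧ ∀ C, Commute C E → Commute C R := by
  let _ : NormedAlgebra ℚ A := .restrictScalars ℚ ℂ A
  have : CompleteSpace A := FiniteDimensional.complete ℂ A
  -- The bicommutant is commutative, so exp turns sums into products on it. It is finite
  -- dimensional, hence complete, so exp reaches a neighbourhood of 1 inside it.
  set Z : Subalgebra ℂ A := Subalgebra.centralizer ℂ (Set.centralizer {E}) with hZ
  have hmemZ : ∀ x, x ∈ Z ↔ ∀ C, Commute C E → Commute C x := by
    intro x
    rw [hZ, Subalgebra.mem_centralizer_iff]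
    refine forall_congr' fun C => ?_
    rw [Set.mem_centralizer_iff]
    simp only [Set.mem_singleton_iff, forall_eq]
    exact ⟨fun h h' => h h'.symm, fun h h' => h h'.symm⟩
  have hEZ : E ∈ Z := (hmemZ E).2 fun C hC => hC
  have hZcomm : ∀ x ∈ Z, ∀ y ∈ Z, Commute x y := by
    intro x hx y hy
    refine (hmemZ y).1 hy x ?_
    exact ((hmemZ x).1 hx E (Commute.refl E)).symm
  have : CompleteSpace Z := FiniteDimensional.complete ℂ Z
  let _ : NormedAlgebra ℚ Z := .restrictScalars ℚ ℂ Z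
  have hexp : ∀ x : Z, NormedSpace.exp (x : A) = (NormedSpace.exp x : Z) := by
    intro x
    exact (NormedSpace.map_exp Z.val continuous_subtype_val x).symm
  have hnear := eventually_exists_exp_eq (B := Z)
  let F : ℂ → A := fun z => 1 + z • (E - 1)
  have hFZ : ∀ z, F z ∈ Z := fun z => add_mem (one_mem _) (Z.smul_mem (sub_mem hEZ (one_mem _)) z)
  have hFc : Continuous F := by fun_prop
  have h0 : (0 : ℂ) ∈ {z : ℂ | IsUnit (1 + z • (E - 1))} := by simp
  have h1 : (1 : ℂ) ∈ {z : ℂ | IsUnit (1 + z • (E - 1))} := by simpa using hE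
  -- Having a logarithm in `Z` is locally constant on the set of z where F z is invertible: for w
  -- near z, F(z)⁻¹F(w) is near 1 and equals some exp x, so logarithms at z and w differ by x. The
  -- property passes from F 0 = 1 to F 1 = E.
  have hiff : (∃ x : Z, NormedSpace.exp (x : A) = F 0) ↔
      (∃ x : Z, NormedSpace.exp (x : A) = F 1) := by
    refine hU.induction₂ (fun z w => (∃ x : Z, NormedSpace.exp (x : A) = F z) ↔
      (∃ x : Z, NormedSpace.exp (x : A) = F w)) ?_
      (fun _ _ _ _ _ _ h h' => h.trans h') (fun _ _ _ _ h => h.symm) h0 h1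
    intro z hz
    obtain ⟨u, hu⟩ := hz
    replace hu : (u : A) = F z := hu
    have huZ : (↑u⁻¹ : A) ∈ Z := by
      rw [hmemZ]
      intro C hC
      have := (hmemZ _).1 (hFZ z) C hC
      rw [← hu] at this
      exact this.units_inv_right
    let g : ℂ → Z := fun w => ⟨↑u⁻¹, huZ⟩ * ⟨F w, hFZ w⟩
    have hg : Continuous g := continuous_const.mul (hFc.subtype_mk hFZ)
    have hgz : g z = 1 := by
      apply Subtype.ext
      change (↑u⁻¹ : A) * F z = 1
      rw [← hu, Units.inv_mul]
    have hev : ∀ᶠ w in nhds z, ∃ x : Z, NormedSpace.exp x = g w := by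
      have := hg.tendsto z
      rw [hgz] at this
      exact this.eventually hnear
    filter_upwards [nhdsWithin_le_nhds hev] with w ⟨x, hx⟩
    have hFw : F w = F z * NormedSpace.exp (x : A) := by
      rw [hexp, hx]
      change _ = F z * ((↑u⁻¹ : A) * F w)
      rw [← mul_assoc, ← hu, Units.mul_inv, one_mul]
    have hFw' : F z = F w * NormedSpace.exp ((-x : Z) : A) := by
      rw [hFw, mul_assoc, ← NormedSpace.exp_add_of_commute (hZcomm _ x.2 _ (-x).2)]
      simp
    constructor
    · rintro ⟨y, hy⟩
      exact ⟨y + x, by rw [hFw, ← hy, ← NormedSpace.exp_add_of_commute (hZcomm _ y.2 _ x.2)]; rfl⟩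
    · rintro ⟨y, hy⟩
      exact ⟨y + -x, by
        rw [hFw', ← hy, ← NormedSpace.exp_add_of_commute (hZcomm _ y.2 _ (-x).2)]; rfl⟩
  obtain ⟨x, hx⟩ := hiff.1 ⟨0, by simp [F]⟩
  refine ⟨x, ?_, (hmemZ _).1 x.2⟩
  rw [hx]
  simp [F]

open Matrix

attribute [local instance] Matrix.linftyOpNormedRing Matrix.linftyOpNormedAlgebra

variable {n : ℕ}

/-- The complex line through `1` and `E` meets the invertible matrices in a connected set. -/
lemma isPreconnected_isUnit_line (E : Matrix (Fin n) (Fin n) ℂ) :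
    IsPreconnected {z : ℂ | IsUnit (1 + z • (E - 1))} := by
  have hfin : {z : ℂ | IsUnit (1 + z • (E - 1))}ᶜ.Countable := by
    -- The excluded z are roots of z ↦ det(1 + z(E - 1)), which is nonzero because its value at 0 is
    -- 1. Removing countably many points from the real plane ℂ leaves it path connected.
    let q : Polynomial ℂ := Matrix.det
      ((1 : Matrix (Fin n) (Fin n) (Polynomial ℂ)) +
        (Polynomial.X : Polynomial ℂ) • (E - 1).map Polynomial.C)
    have hq : ∀ z, q.eval z = (1 + z • (E - 1)).det := by
      intro z
      rw [← Polynomial.coe_evalRingHom, RingHom.map_det]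
      congr 1
      ext i j
      by_cases hij : i = j
      · simp [hij]
      · simp [hij, mul_comm z]
    have hq0 : q ≠ 0 := by
      intro h
      have := hq 0
      simp [h] at this
    refine (Set.Finite.subset (q.roots.toFinset.finite_toSet) ?_).countable
    intro z hz
    simp only [Finset.mem_coe, Multiset.mem_toFinset]
    rw [Polynomial.mem_roots hq0, Polynomial.IsRoot, hq]
    by_contra hne
    exact hz ((Matrix.isUnit_iff_isUnit_det _).2 (isUnit_iff_ne_zero.2 hne))
  have := hfin.isPathConnected_compl_of_one_lt_rank (E := ℂ)
    (by rw [Complex.rank_real_complex]; exact Nat.one_lt_ofNat)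
  rw [compl_compl] at this
  exact this.isConnected.isPreconnected

/-- An invertible complex matrix is of the form `exp (2πi R)` with `R` in its bicommutant. -/
lemma exists_two_pi_I_log {E : Matrix (Fin n) (Fin n) ℂ} (hE : IsUnit E) :
    ∃ R : Matrix (Fin n) (Fin n) ℂ, NormedSpace.exp ((2 * (Real.pi : ℂ) * Complex.I) • R) = E ∧
      ∀ C, Commute C E → Commute C R := by
  obtain ⟨R, hR, hcomm⟩ := exists_log_of_isPreconnected hE (isPreconnected_isUnit_line E)
  refine ⟨(2 * (Real.pi : ℂ) * Complex.I)⁻¹ • R, ?_, fun C hC => (hcomm C hC).smul_right _⟩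
  rw [smul_smul, mul_inv_cancel₀ Complex.two_pi_I_ne_zero, one_smul]
  exact hR

end Log

/-! ### Functions and Euler operators generate D(T). -/

section Generation

variable {l : ℕ}

/-- Multiplication by the monomial `t^m`. -/
abbrev monOp (m : Fin l → ℤ) : Module.End ℂ (CoordRing l) :=
  mulOp ℂ (AddMonoidAlgebra.single m 1)

lemma monOp_add (m m' : Fin l → ℤ) : monOp (m + m') = monOp m * monOp m' := by
  refine LinearMap.ext fun x => ?_
  simp [← mul_assoc, AddMonoidAlgebra.single_mul_single]

lemma monOp_zero : monOp (0 : Fin l → ℤ) = 1 := by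
  refine LinearMap.ext fun x => ?_
  simp [← AddMonoidAlgebra.one_def]

lemma monOp_neg_mul (m : Fin l → ℤ) : monOp (-m) * monOp m = 1 := by
  rw [← monOp_add, neg_add_cancel, monOp_zero]

lemma monOp_mul_neg (m : Fin l → ℤ) : monOp m * monOp (-m) = 1 := by
  rw [← monOp_add, add_neg_cancel, monOp_zero]

lemma endomorphism_ext {V : Type*} [AddCommGroup V] [Module ℂ V] {P Q : CoordRing l →ₗ[ℂ] V}
    (h : ∀ m, P (AddMonoidAlgebra.single m 1) = Q (AddMonoidAlgebra.single m 1)) : P = Q := by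
  refine LinearMap.ext fun x => ?_
  induction x using AddMonoidAlgebra.induction_linear with
  | zero => simp
  | add f g hf hg => simp [hf, hg]
  | single m c =>
    have : (AddMonoidAlgebra.single m c : CoordRing l) = c • AddMonoidAlgebra.single m 1 := by
      simp
    rw [this, map_smul, map_smul, h]

/-- By this relation, conjugation by a monomial shifts the argument of a polynomial in the Euler
operators, which makes `diffShift` a finite difference. -/
lemma eulerMap_mul_monOp (j : Fin l) (m : Fin l → ℤ) :
    eulerMap j * monOp m = monOp m * (eulerMap j + (m j : ℂ) • 1) := by
  apply endomorphism_ext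
  intro k
  simp [eulerMap_single, AddMonoidAlgebra.single_mul_single, ← AddMonoidAlgebra.single_add, add_comm]

/-- The additive subgroup of exponents is generated by the standard basis vectors. -/
lemma exponent_induction {p : (Fin l → ℤ) → Prop} (h0 : p 0)
    (hs : ∀ i, p (Pi.single i 1)) (ha : ∀ m m', p m → p m' → p (m + m'))
    (hn : ∀ m, p m → p (-m)) (m : Fin l → ℤ) : p m := by
  let H : AddSubgroup (Fin l → ℤ) :=
    { carrier := {m | p m}, zero_mem' := h0, add_mem' := fun {a b} => ha a b
      neg_mem' := fun {a} => hn a }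
  change m ∈ H
  have : m = ∑ i, m i • (Pi.single i 1 : Fin l → ℤ) := by
    ext j
    simp [Finset.sum_apply, Pi.single_apply]
  rw [this]
  exact H.sum_mem fun i _ => H.zsmul_mem (hs i) _

lemma commute_monOp {P : Module.End ℂ (CoordRing l)}
    (h : ∀ i, Commute P (monOp (Pi.single i 1))) (m : Fin l → ℤ) : Commute P (monOp m) := by
  induction m using exponent_induction with
  | h0 => rw [monOp_zero]; exact Commute.one_right P
  | hs i => exact h i
  | ha m m' hm hm' => rw [monOp_add]; exact hm.mul_right hm'
  | hn m hm =>
    have h1 : monOp (-m) * (P * monOp m) * monOp (-m) = monOp (-m) * (monOp m * P) * monOp (-m) := by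
      rw [hm.eq]
    rw [← mul_assoc (monOp (-m)) (monOp m), monOp_neg_mul, one_mul, mul_assoc, mul_assoc,
      monOp_mul_neg, mul_one] at h1
    exact h1.symm

/-- Commuting with the t_i forces commuting with their inverses, hence with all monomials, and these
span the ring from 1. -/
lemma eq_mulOp_of_commute {P : Module.End ℂ (CoordRing l)}
    (h : ∀ i, Commute P (monOp (Pi.single i 1))) : P = mulOp ℂ (P 1) := by
  apply endomorphism_ext
  intro m
  have := LinearMap.congr_fun (commute_monOp h m).eq 1
  simp only [Module.End.mul_apply, LinearMap.mulLeft_apply, mul_one] at this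
  rw [this, LinearMap.mulLeft_apply, mul_comm]

variable (l) in
/-- The ring of operators generated by the functions and the Euler operators `tᵢ∂ᵢ`. -/
def eulerSubring : Subring (Module.End ℂ (CoordRing l)) :=
  Subring.closure (Set.range (mulOp ℂ) ∪ Set.range eulerMap)

lemma mulOp_mem_eulerSubring (f : CoordRing l) : mulOp ℂ f ∈ eulerSubring l :=
  Subring.subset_closure (Or.inl ⟨f, rfl⟩)

lemma eulerMap_mem_eulerSubring (i : Fin l) : eulerMap i ∈ eulerSubring l :=
  Subring.subset_closure (Or.inr ⟨i, rfl⟩)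

lemma smul_mem_eulerSubring {P : Module.End ℂ (CoordRing l)} (hP : P ∈ eulerSubring l) (c : ℂ) :
    c • P ∈ eulerSubring l := by
  have h : c • P = mulOp ℂ (algebraMap ℂ (CoordRing l) c) * P := by
    refine LinearMap.ext fun x => ?_
    simp [Algebra.smul_def]
  rw [h]
  exact mul_mem (mulOp_mem_eulerSubring _) hP

/-- The multiplicative difference operator `P ↦ tⱼ⁻¹ P tⱼ - P`. -/
def diffShift (j : Fin l) (P : Module.End ℂ (CoordRing l)) : Module.End ℂ (CoordRing l) :=
  monOp (-Pi.single j 1) * P * monOp (Pi.single j 1) - P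

/-- Up to a unit the difference is the commutator with t_j. Hence it lowers the order of a
differential operator and vanishes exactly on operators commuting with t_j. -/
lemma diffShift_eq (j : Fin l) (P : Module.End ℂ (CoordRing l)) :
    diffShift j P = monOp (-Pi.single j 1) *
      (P * monOp (Pi.single j 1) - monOp (Pi.single j 1) * P) := by
  rw [diffShift, mul_sub, ← mul_assoc, ← mul_assoc, monOp_neg_mul, one_mul]

lemma diffShift_sub (j : Fin l) (P Q : Module.End ℂ (CoordRing l)) :
    diffShift j (P - Q) = diffShift j P - diffShift j Q := by
  simp only [diffShift, mul_sub, sub_mul]; abel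

lemma diffShift_smul (j : Fin l) (c : ℂ) (P : Module.End ℂ (CoordRing l)) :
    diffShift j (c • P) = c • diffShift j P := by
  simp only [diffShift, mul_smul_comm, smul_mul_assoc, smul_sub]

lemma diffShift_iterate_smul (j : Fin l) (c : ℂ) (P : Module.End ℂ (CoordRing l)) (r : ℕ) :
    (diffShift j)^[r] (c • P) = c • (diffShift j)^[r] P := by
  induction r generalizing P with
  | zero => rfl
  | succ r ih => rw [Function.iterate_succ_apply, Function.iterate_succ_apply, diffShift_smul, ih]

lemma diffShift_iterate_sub (j : Fin l) (P Q : Module.End ℂ (CoordRing l)) (r : ℕ) :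
    (diffShift j)^[r] (P - Q) = (diffShift j)^[r] P - (diffShift j)^[r] Q := by
  induction r generalizing P Q with
  | zero => rfl
  | succ r ih => simp only [Function.iterate_succ_apply, diffShift_sub, ih]

lemma diffShift_eq_zero_iff (j : Fin l) (P : Module.End ℂ (CoordRing l)) :
    diffShift j P = 0 ↔ Commute P (monOp (Pi.single j 1)) := by
  rw [diffShift_eq]
  constructor
  · intro h
    have := congrArg (monOp (Pi.single j 1) * ·) h
    simp only [mul_zero, ← mul_assoc (monOp (Pi.single j 1)) (monOp (-Pi.single j 1)), monOp_mul_neg,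
      one_mul] at this
    exact sub_eq_zero.1 this
  · intro h
    rw [h.eq, sub_self, mul_zero]

/-- Operators commuting with t_j play the role of constants for the difference in direction j. -/
lemma diffShift_mul (j : Fin l) (P Q : Module.End ℂ (CoordRing l))
    (h : Commute Q (monOp (Pi.single j 1))) : diffShift j (Q * P) = Q * diffShift j P := by
  have h' : Commute Q (monOp (-Pi.single j 1)) := by
    have h1 : monOp (-Pi.single j 1) * (Q * monOp (Pi.single j 1)) * monOp (-Pi.single j 1)
        = monOp (-Pi.single j 1) * (monOp (Pi.single j 1) * Q) * monOp (-Pi.single j 1) := by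
      rw [h.eq]
    rw [← mul_assoc (monOp (-Pi.single j 1)) (monOp (Pi.single j 1)), monOp_neg_mul, one_mul,
      mul_assoc, mul_assoc, monOp_mul_neg, mul_one] at h1
    exact h1.symm
  rw [diffShift, diffShift, mul_sub, ← mul_assoc, ← h'.eq]
  simp only [mul_assoc]

lemma diffShift_iterate_mul (j : Fin l) (P Q : Module.End ℂ (CoordRing l))
    (h : Commute Q (monOp (Pi.single j 1))) (r : ℕ) :
    (diffShift j)^[r] (Q * P) = Q * (diffShift j)^[r] P := by
  induction r generalizing P with
  | zero => rfl
  | succ r ih => rw [Function.iterate_succ_apply, Function.iterate_succ_apply,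
      diffShift_mul j P Q h, ih]

lemma commute_diffShift {i : Fin l} (j : Fin l) {P : Module.End ℂ (CoordRing l)}
    (h : Commute P (monOp (Pi.single i 1))) :
    Commute (diffShift j P) (monOp (Pi.single i 1)) := by
  have hm : ∀ m m' : Fin l → ℤ, Commute (monOp m) (monOp m') := fun m m' => by
    change _ * _ = _ * _
    rw [← monOp_add, ← monOp_add, add_comm]
  exact (((hm _ _).mul_left h).mul_left (hm _ _)).sub_left h

/-- The falling factorial `θ(θ-1)⋯(θ-r+1)` of the Euler operator `θ = tⱼ∂ⱼ`. -/
def fallingEuler (j : Fin l) : ℕ → Module.End ℂ (CoordRing l)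
  | 0 => 1
  | r + 1 => fallingEuler j r * (eulerMap j - (r : ℂ) • 1)

lemma fallingEuler_mem (j : Fin l) (r : ℕ) : fallingEuler j r ∈ eulerSubring l := by
  induction r with
  | zero => exact one_mem _
  | succ r ih =>
    exact mul_mem ih (sub_mem (eulerMap_mem_eulerSubring j) (smul_mem_eulerSubring (one_mem _) _))

lemma commute_fallingEuler_of_ne {i j : Fin l} (hij : i ≠ j) (r : ℕ) :
    Commute (fallingEuler j r) (monOp (Pi.single i 1)) := by
  induction r with
  | zero => exact Commute.one_left _
  | succ r ih =>
    refine ih.mul_left (Commute.sub_left ?_ ((Commute.one_left _).smul_left _))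
    change _ * _ = _ * _
    rw [eulerMap_mul_monOp]
    simp [hij.symm]

/-- The discrete form of (x^(r+1))' = (r+1)x^r. After θ ↦ θ + 1 the common factor θ⋯(θ-r+1) comes
out and (θ+1) - (θ-r) = r + 1 remains. -/
lemma diffShift_fallingEuler_succ (j : Fin l) (r : ℕ) :
    diffShift j (fallingEuler j (r + 1)) = ((r : ℂ) + 1) • fallingEuler j r := by
  rw [diffShift, sub_eq_iff_eq_add]
  induction r with
  | zero =>
    simp only [fallingEuler, one_mul, Nat.cast_zero, zero_smul, sub_zero, mul_assoc,
      eulerMap_mul_monOp, Pi.single_eq_same, Int.cast_one, zero_add, one_smul]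
    rw [← mul_assoc, monOp_neg_mul, one_mul, add_comm]
  | succ r ih =>
    have h1 : fallingEuler j (r + 1 + 1) * monOp (Pi.single j 1) =
        fallingEuler j (r + 1) * monOp (Pi.single j 1) * (eulerMap j - (r : ℂ) • 1) := by
      rw [fallingEuler, mul_assoc, mul_assoc]
      congr 1
      rw [sub_mul, eulerMap_mul_monOp]
      simp only [Pi.single_eq_same, Int.cast_one, mul_add, mul_sub, smul_mul_assoc, mul_smul_comm,
        one_mul, mul_one, Nat.cast_add, Nat.cast_one, add_smul, one_smul, add_mul]
      abel
    rw [mul_assoc, h1, ← mul_assoc, ← mul_assoc, ih]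
    have h2 : fallingEuler j (r + 1 + 1) =
      fallingEuler j (r + 1) * (eulerMap j - ((r + 1 : ℕ) : ℂ) • 1) := rfl
    have h3 : fallingEuler j (r + 1) =
      fallingEuler j r * (eulerMap j - (r : ℂ) • 1) := rfl
    rw [h2, add_mul, smul_mul_assoc, ← h3]
    simp only [mul_sub, mul_add, mul_smul_comm, mul_one, Nat.cast_add, Nat.cast_one, add_smul,
      one_smul]
    abel

lemma diffShift_iterate_fallingEuler (j : Fin l) (r : ℕ) :
    (diffShift j)^[r] (fallingEuler j r) = (r.factorial : ℂ) • 1 := by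
  induction r with
  | zero => simp [fallingEuler]
  | succ r ih =>
    rw [Function.iterate_succ_apply, diffShift_fallingEuler_succ, diffShift_iterate_smul, ih,
      smul_smul, Nat.factorial_succ]
    push_cast
    rfl

/-- A differential operator which commutes with `t₁, …, t_d` is generated by functions and Euler
operators. -/
lemma mem_eulerSubring_of_commute (d : ℕ) (hd : d ≤ l) (P : Module.End ℂ (CoordRing l))
    (hcomm : ∀ i : Fin l, (i : ℕ) < d → Commute P (monOp (Pi.single i 1)))
    (hdiff : ∃ N, IsDiffOpOfOrder ℂ N P) : P ∈ eulerSubring l := by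
  have hshift : ∀ (j : Fin l) (N : ℕ) (Q : Module.End ℂ (CoordRing l)),
      IsDiffOpOfOrder ℂ (N + 1) Q → IsDiffOpOfOrder ℂ N (diffShift j Q) := by
    intro j N Q hQ
    rw [diffShift_eq]
    simpa using (isDiffOpOfOrder_mulOp (k := ℂ) (AddMonoidAlgebra.single (-Pi.single j 1) 1)).mul
      (hQ (AddMonoidAlgebra.single (Pi.single j 1) 1))
  -- Each difference lowers the order by one, and an operator of order 0 needs one more to vanish.
  have hshift0 : ∀ (j : Fin l) (N : ℕ) (Q : Module.End ℂ (CoordRing l)),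
      IsDiffOpOfOrder ℂ N Q → (diffShift j)^[N + 1] Q = 0 := by
    intro j N
    induction N with
    | zero => intro Q hQ; simp only [Function.iterate_succ, Function.iterate_zero,
        Function.comp_apply, id]; rw [diffShift_eq, hQ, mul_zero]
    | succ N ih => intro Q hQ; rw [Function.iterate_succ_apply]; exact ih _ (hshift j N Q hQ)
  -- Descending induction on d: for d = l the operator is multiplication by a function, and the step
  -- from d + 1 to d expands P in powers of θ_j for the coordinate j of index d.
  induction hd using Nat.decreasingInduction generalizing P with
  | self =>
    rw [eq_mulOp_of_commute fun i => hcomm i i.2]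
    exact mulOp_mem_eulerSubring _
  | of_succ d hdl ih =>
    set j : Fin l := ⟨d, hdl⟩ with hj
    have key : ∀ (r : ℕ) (P : Module.End ℂ (CoordRing l)),
        (∀ i : Fin l, (i : ℕ) < d → Commute P (monOp (Pi.single i 1))) →
        (∃ N, IsDiffOpOfOrder ℂ N P) → (diffShift j)^[r] P = 0 → P ∈ eulerSubring l := by
      intro r
      induction r with
      | zero => intro P _ _ h; rw [show P = 0 from h]; exact zero_mem _
      | succ r ihr =>
        intro P hcomm hN h
        set Q := (diffShift j)^[r] P with hQ
        have hQj : Commute Q (monOp (Pi.single j 1)) := by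
          rw [← diffShift_eq_zero_iff, hQ, ← Function.iterate_succ_apply' (diffShift j), h]
        have hQi : ∀ i : Fin l, (i : ℕ) < d → Commute Q (monOp (Pi.single i 1)) := by
          intro i hi
          rw [hQ]
          clear hQj hQ Q h ihr
          induction r with
          | zero => exact hcomm i hi
          | succ r ihr => rw [Function.iterate_succ_apply']; exact commute_diffShift j ihr
        have hQN : ∃ N, IsDiffOpOfOrder ℂ N Q := by
          rw [hQ]
          clear hQj hQi hQ Q h ihr
          induction r with
          | zero => exact hN
          | succ r ihr =>
            obtain ⟨N, hN⟩ := ihr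
            rw [Function.iterate_succ_apply']
            exact ⟨N, hshift j N _ hN.succ⟩
        have hQmem : Q ∈ eulerSubring l := by
          refine ih Q (fun i hi => ?_) hQN
          rcases Nat.lt_succ_iff_lt_or_eq.1 hi with hlt | heq
          · exact hQi i hlt
          · rw [show i = j from Fin.ext heq]; exact hQj
        -- Newton's forward difference formula: b is the binomial coefficient (θ_j choose r), whose
        -- r-th difference is 1. Subtracting Qb therefore kills the r-th difference of P, while Q
        -- commutes with one more coordinate and is covered by `ih`.
        set b := ((r.factorial : ℂ)⁻¹) • fallingEuler j r with hb
        have hbmem : b ∈ eulerSubring l := smul_mem_eulerSubring (fallingEuler_mem j r) _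
        have hbN : ∃ N, IsDiffOpOfOrder ℂ N b := by
          have he : eulerMap j ∈ diffOps ℂ (CoordRing l) :=
            ⟨1, isDiffOpOfOrder_derivation (eulerDer j)⟩
          have : fallingEuler j r ∈ diffOps ℂ (CoordRing l) := by
            clear_value Q b
            clear hb hbmem hQ hQj hQi hQN hQmem h ihr
            induction r with
            | zero => exact one_mem _
            | succ r ihr => exact mul_mem ihr (sub_mem he (Subalgebra.smul_mem _ (one_mem _) _))
          exact Subalgebra.smul_mem _ this _
        have hP : P - Q * b ∈ eulerSubring l := by
          refine ihr _ (fun i hi => ?_) ?_ ?_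
          · refine (hcomm i hi).sub_left ((hQi i hi).mul_left ?_)
            refine (commute_fallingEuler_of_ne ?_ r).smul_left _
            rintro rfl
            exact absurd hi (lt_irrefl _)
          · exact (diffOps ℂ (CoordRing l)).sub_mem hN ((diffOps ℂ (CoordRing l)).mul_mem hQN hbN)
          · rw [diffShift_iterate_sub, diffShift_iterate_mul j b Q hQj, hb, diffShift_iterate_smul,
              diffShift_iterate_fallingEuler, smul_smul,
              inv_mul_cancel₀ (Nat.cast_ne_zero.2 r.factorial_ne_zero), one_smul, mul_one, sub_self]
        simpa using add_mem hP (mul_mem hQmem hbmem)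
    obtain ⟨N, hN⟩ := hdiff
    exact key (N + 1) P hcomm ⟨N, hN⟩ (hshift0 j N P hN)

/-- The algebra of differential operators on the torus is generated by functions and Euler
operators. -/
lemma mem_eulerSubring_of_mem_diffOps {P : Module.End ℂ (CoordRing l)}
    (hP : P ∈ diffOps ℂ (CoordRing l)) : P ∈ eulerSubring l :=
  mem_eulerSubring_of_commute 0 (Nat.zero_le l) P (fun _ hi => absurd hi (Nat.not_lt_zero _)) hP

end Generation

/-! ### The D(T)-action defined by a commuting family of matrices. -/

section Action

variable {l n : ℕ}

/-- The section `t^m u` of the trivial bundle. -/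
def constVec (m : Fin l → ℤ) (u : Fin n → ℂ) : Fin n → CoordRing l :=
  fun i => AddMonoidAlgebra.single m (u i)

/-- The coefficient of `t^m` in a section of the trivial bundle. -/
def coeffVec (s : Fin n → CoordRing l) (m : Fin l → ℤ) : Fin n → ℂ := fun i => (s i).coeff m

lemma coeffVec_ext {s s' : Fin n → CoordRing l} (h : ∀ m, coeffVec s m = coeffVec s' m) :
    s = s' := by
  funext i
  ext m
  exact congrFun (h m) i

lemma coeffVec_add (s s' : Fin n → CoordRing l) (m : Fin l → ℤ) :
    coeffVec (s + s') m = coeffVec s m + coeffVec s' m := rfl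

lemma coeffVec_constVec_self (m : Fin l → ℤ) (u : Fin n → ℂ) : coeffVec (constVec m u) m = u := by
  funext i
  simp [coeffVec, constVec]

lemma coeffVec_constVec_of_ne {m m' : Fin l → ℤ} (h : m ≠ m') (u : Fin n → ℂ) :
    coeffVec (constVec m u) m' = 0 := by
  funext i
  simp [coeffVec, constVec, h]

lemma constVec_ext {V : Type*} [AddCommGroup V] [Module ℂ V]
    {P Q : (Fin n → CoordRing l) →ₗ[ℂ] V} (h : ∀ m u, P (constVec m u) = Q (constVec m u)) :
    P = Q := by
  refine LinearMap.pi_ext' fun i => endomorphism_ext fun m => ?_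
  have : constVec m (Pi.single i (1 : ℂ)) =
      (Pi.single i (AddMonoidAlgebra.single m 1) : Fin n → CoordRing l) := by
    funext j
    by_cases hij : j = i
    · subst hij; simp [constVec]
    · simp [constVec, hij]
  simpa [this] using h m (Pi.single i 1)

lemma coeff_eulerMap (k : Fin l) (f : CoordRing l) (m : Fin l → ℤ) :
    (eulerMap k f).coeff m = m k * f.coeff m := by
  induction f using AddMonoidAlgebra.induction_linear with
  | zero => simp
  | add f g hf hg => simp [hf, hg, mul_add]
  | single m' c =>
    rw [eulerMap_single]
    by_cases h : m' = m
    · subst h; simp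
    · simp [h]

/-- The connection operator `θ_k + A_k` on the trivial bundle, for `θ_k = t_k ∂/∂t_k`. -/
def covDer (A : Fin l → Matrix (Fin n) (Fin n) ℂ) (k : Fin l) :
    Module.End ℂ (Fin n → CoordRing l) :=
  (eulerMap k).compLeft (Fin n) +
    (((A k).map (algebraMap ℂ (CoordRing l))).mulVecLin).restrictScalars ℂ

lemma covDer_apply (A : Fin l → Matrix (Fin n) (Fin n) ℂ) (k : Fin l) (s : Fin n → CoordRing l) :
    covDer A k s = (fun i => eulerMap k (s i)) +
      ((A k).map (algebraMap ℂ (CoordRing l))).mulVec s := rfl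

lemma coeffVec_mulVec (C : Matrix (Fin n) (Fin n) ℂ) (s : Fin n → CoordRing l) (m : Fin l → ℤ) :
    coeffVec ((C.map (algebraMap ℂ (CoordRing l))).mulVec s) m = C.mulVec (coeffVec s m) := by
  funext i
  simp only [coeffVec, Matrix.mulVec, dotProduct, Matrix.map_apply, AddMonoidAlgebra.coeff_sum,
    Finsupp.finsetSum_apply, ← Algebra.smul_def, AddMonoidAlgebra.coeff_smul_apply, smul_eq_mul]

lemma coeffVec_covDer (A : Fin l → Matrix (Fin n) (Fin n) ℂ) (k : Fin l)
    (s : Fin n → CoordRing l) (m : Fin l → ℤ) :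
    coeffVec (covDer A k s) m = (m k : ℂ) • coeffVec s m + (A k).mulVec (coeffVec s m) := by
  rw [covDer_apply, coeffVec_add, coeffVec_mulVec]
  congr 1
  funext i
  simp [coeffVec, coeff_eulerMap]

lemma covDer_constVec (A : Fin l → Matrix (Fin n) (Fin n) ℂ) (k : Fin l) (m : Fin l → ℤ)
    (u : Fin n → ℂ) :
    covDer A k (constVec m u) = constVec m ((m k : ℂ) • u + (A k).mulVec u) := by
  refine coeffVec_ext fun m' => ?_
  rw [coeffVec_covDer]
  by_cases h : m = m'
  · subst h
    simp only [coeffVec_constVec_self]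
  · simp only [coeffVec_constVec_of_ne h, Matrix.mulVec_zero, smul_zero, add_zero]

/-- Polynomials can be evaluated on a commuting family of matrices. -/
lemma exists_aeval_of_commute {A : Fin l → Matrix (Fin n) (Fin n) ℂ}
    (hA : ∀ i j, Commute (A i) (A j)) :
    ∃ φ : MvPolynomial (Fin l) ℂ →ₐ[ℂ] Matrix (Fin n) (Fin n) ℂ,
      ∀ i, φ (MvPolynomial.X i) = A i := by
  -- Evaluation of polynomials needs a commutative target, which the subalgebra generated by the A_i
  -- provides.
  have := Algebra.isMulCommutative_adjoin ℂ (s := Set.range A)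
    (by rintro _ ⟨i, rfl⟩ _ ⟨j, rfl⟩; exact hA i j)
  let _ : CommRing (Algebra.adjoin ℂ (Set.range A)) :=
    { (Algebra.adjoin ℂ (Set.range A)).toRing with mul_comm := this.is_comm.comm }
  let a : Fin l → Algebra.adjoin ℂ (Set.range A) :=
    fun i => ⟨A i, Algebra.subset_adjoin ⟨i, rfl⟩⟩
  refine ⟨(Algebra.adjoin ℂ (Set.range A)).val.comp (MvPolynomial.aeval a), fun i => ?_⟩
  simp [a]

/-- The shift `p(x) ↦ p(x + m)` of polynomials. -/
def shiftPoly (m : Fin l → ℤ) : MvPolynomial (Fin l) ℂ →ₐ[ℂ] MvPolynomial (Fin l) ℂ :=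
  MvPolynomial.aeval fun i => MvPolynomial.X i + MvPolynomial.C (m i : ℂ)

/-- A polynomial which vanishes at all integral points is zero. -/
lemma eq_zero_of_eval_intCast {p : MvPolynomial (Fin l) ℂ}
    (h : ∀ m : Fin l → ℤ, MvPolynomial.eval (fun i => (m i : ℂ)) p = 0) : p = 0 := by
  refine MvPolynomial.funext_set (fun _ => Set.range ((↑) : ℤ → ℂ))
    (fun _ => Set.infinite_range_of_injective Int.cast_injective) fun x hx => ?_
  choose m hm using fun i => hx i (Set.mem_univ i)
  rw [map_zero, ← h m]
  congr 2
  funext i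
  exact (hm i).symm

/-- The operators `P` on functions and `P'` on sections have the same polynomial symbol, evaluated
at the integral points and at their translates by the commuting family `φ(X)` respectively. -/
def SameSymbol (φ : MvPolynomial (Fin l) ℂ →ₐ[ℂ] Matrix (Fin n) (Fin n) ℂ)
    (x : Module.End ℂ (CoordRing l) × Module.End ℂ (Fin n → CoordRing l)) : Prop :=
  ∀ κ : Fin l → ℤ, ∃ p : MvPolynomial (Fin l) ℂ, ∀ m : Fin l → ℤ,
    (x.1 (AddMonoidAlgebra.single m 1)).coeff (m + κ) = MvPolynomial.eval (fun i => (m i : ℂ)) p ∧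
    ∀ u, coeffVec (x.2 (constVec m u)) (m + κ) = (φ (shiftPoly m p)).mulVec u

variable {φ : MvPolynomial (Fin l) ℂ →ₐ[ℂ] Matrix (Fin n) (Fin n) ℂ}

lemma SameSymbol.zero : SameSymbol φ (0 : _ × _) := fun κ => ⟨0, fun m => ⟨by simp, fun u => by
  simp only [Prod.snd_zero, LinearMap.zero_apply, map_zero, Matrix.zero_mulVec]; rfl⟩⟩

lemma SameSymbol.one : SameSymbol φ (1 : _ × _) := fun κ => by
  by_cases h : κ = 0
  · subst h
    refine ⟨1, fun m => ⟨by simp, fun u => ?_⟩⟩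
    simp only [Prod.snd_one, Module.End.one_apply, add_zero, coeffVec_constVec_self, map_one,
      Matrix.one_mulVec]
  · have hne : ∀ m : Fin l → ℤ, m ≠ m + κ := fun m => by simpa using h
    refine ⟨0, fun m => ⟨by simp [hne], fun u => ?_⟩⟩
    simp only [Prod.snd_one, Module.End.one_apply, map_zero, Matrix.zero_mulVec]
    exact coeffVec_constVec_of_ne (hne m) u

lemma SameSymbol.add {x y : Module.End ℂ (CoordRing l) × Module.End ℂ (Fin n → CoordRing l)}
    (hx : SameSymbol φ x) (hy : SameSymbol φ y) : SameSymbol φ (x + y) := fun κ => by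
  obtain ⟨p, hp⟩ := hx κ
  obtain ⟨q, hq⟩ := hy κ
  refine ⟨p + q, fun m => ⟨?_, fun u => ?_⟩⟩
  · simp [(hp m).1, (hq m).1]
  · rw [Prod.snd_add, LinearMap.add_apply, coeffVec_add, (hp m).2, (hq m).2, map_add, map_add,
      Matrix.add_mulVec]

lemma SameSymbol.neg {x : Module.End ℂ (CoordRing l) × Module.End ℂ (Fin n → CoordRing l)}
    (hx : SameSymbol φ x) : SameSymbol φ (-x) := fun κ => by
  obtain ⟨p, hp⟩ := hx κ
  refine ⟨-p, fun m => ⟨?_, fun u => ?_⟩⟩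
  · simp [(hp m).1]
  · rw [map_neg, map_neg, Matrix.neg_mulVec, ← (hp m).2]
    rfl

/-- Multiplication by a function, on functions and on sections. -/
def funPair (f : CoordRing l) :
    Module.End ℂ (CoordRing l) × Module.End ℂ (Fin n → CoordRing l) :=
  (mulOp ℂ f, LinearMap.lsmul (CoordRing l) (Fin n → CoordRing l) f |>.restrictScalars ℂ)

/-- Multiplication by c t^j moves the part of degree κ - j to degree κ and scales its symbol by c,
on functions and sections alike. -/
lemma SameSymbol.funPair_mul (f : CoordRing l)
    {x : Module.End ℂ (CoordRing l) × Module.End ℂ (Fin n → CoordRing l)}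
    (hx : SameSymbol φ x) : SameSymbol φ (funPair f * x) := by
  induction f using AddMonoidAlgebra.induction_linear with
  | zero =>
    have : funPair (0 : CoordRing l) * x = 0 := by
      refine Prod.ext (LinearMap.ext fun _ => ?_) (LinearMap.ext fun _ => ?_) <;>
        simp [funPair]
    rw [this]
    exact SameSymbol.zero
  | add f g hf hg =>
    have : funPair (f + g) * x = funPair f * x + funPair g * x := by
      refine Prod.ext (LinearMap.ext fun _ => ?_) (LinearMap.ext fun _ => ?_) <;>
        simp [funPair, add_mul]
    rw [this]
    exact hf.add hg
  | single j c =>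
    intro κ
    obtain ⟨p, hp⟩ := hx (κ - j)
    have hκ : ∀ m : Fin l → ℤ, m + κ = j + (m + (κ - j)) := fun m => by abel
    refine ⟨c • p, fun m => ⟨?_, fun u => ?_⟩⟩
    · rw [hκ, MvPolynomial.smul_eval, ← (hp m).1]
      simp [funPair]
    · rw [hκ, map_smul, map_smul, Matrix.smul_mulVec, ← (hp m).2]
      funext i
      simp [funPair, coeffVec]

/-- On degree m + κ the two operators act by m_k + κ_k and by m_k + κ_k + A_k. These are the values
of X_k + κ_k at m and at m + A, so the symbol is multiplied by X_k + κ_k. -/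
lemma SameSymbol.eulerMap_mul {A : Fin l → Matrix (Fin n) (Fin n) ℂ}
    (hφ : ∀ i, φ (MvPolynomial.X i) = A i) (k : Fin l)
    {x : Module.End ℂ (CoordRing l) × Module.End ℂ (Fin n → CoordRing l)}
    (hx : SameSymbol φ x) : SameSymbol φ ((eulerMap k, covDer A k) * x) := fun κ => by
  obtain ⟨p, hp⟩ := hx κ
  refine ⟨(MvPolynomial.X k + MvPolynomial.C (κ k : ℂ)) * p, fun m => ⟨?_, fun u => ?_⟩⟩
  · rw [map_mul, ← (hp m).1]
    simp [coeff_eulerMap]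
  · rw [map_mul, map_mul, ← Matrix.mulVec_mulVec, ← (hp m).2]
    have : φ (shiftPoly m (MvPolynomial.X k + MvPolynomial.C (κ k : ℂ))) =
        ((m + κ) k : ℂ) • 1 + A k := by
      rw [map_add, shiftPoly, MvPolynomial.aeval_X, MvPolynomial.aeval_C, map_add, map_add, hφ,
        ← MvPolynomial.algebraMap_eq, AlgHom.commutes, AlgHom.commutes, Algebra.algebraMap_eq_smul_one,
        Algebra.algebraMap_eq_smul_one, add_assoc, ← add_smul, add_comm]
      simp
    rw [this, Prod.snd_mul, Module.End.mul_apply, coeffVec_covDer, Matrix.add_mulVec,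
      Matrix.smul_mulVec, Matrix.one_mulVec]

variable (A : Fin l → Matrix (Fin n) (Fin n) ℂ)

/-- The ring of pairs of operators generated by functions and by the Euler operators together with
the connection operators. -/
def pairSubring : Subring (Module.End ℂ (CoordRing l) × Module.End ℂ (Fin n → CoordRing l)) :=
  Subring.closure (Set.range funPair ∪ Set.range fun k => (eulerMap k, covDer A k))

variable {A}

/-- Closure under arbitrary products is avoided: left multiplication by each generator preserves the
property, hence so does left multiplication by the whole ring, which is then applied to 1. -/
lemma sameSymbol_of_mem_pairSubring (hφ : ∀ i, φ (MvPolynomial.X i) = A i)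
    {x : Module.End ℂ (CoordRing l) × Module.End ℂ (Fin n → CoordRing l)}
    (hx : x ∈ pairSubring A) : SameSymbol φ x := by
  suffices h : ∀ y, SameSymbol φ y → SameSymbol φ (x * y) by simpa using h 1 SameSymbol.one
  induction hx using Subring.closure_induction with
  | mem x hx =>
    rcases hx with ⟨f, rfl⟩ | ⟨k, rfl⟩
    · exact fun y hy => hy.funPair_mul f
    · exact fun y hy => hy.eulerMap_mul hφ k
  | zero => intro y _; rw [zero_mul]; exact SameSymbol.zero
  | one => intro y hy; rwa [one_mul]
  | add x x' _ _ hx hx' => intro y hy; rw [add_mul]; exact (hx y hy).add (hx' y hy)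
  | neg x _ hx => intro y hy; have h : -x * y = -(x * y) := neg_mul x y; rw [h]; exact (hx y hy).neg
  | mul x x' _ _ hx hx' => intro y hy; rw [mul_assoc]; exact hx _ (hx' y hy)

/-- Every relation between operators on functions lifts to sections: a vanishing operator has
symbols that are zero at all integer points, so they are zero polynomials and also vanish at m + A.
-/
lemma eq_zero_of_mem_pairSubring (hA : ∀ i j, Commute (A i) (A j))
    {x : Module.End ℂ (CoordRing l) × Module.End ℂ (Fin n → CoordRing l)}
    (hx : x ∈ pairSubring A) (h0 : x.1 = 0) : x = 0 := by
  obtain ⟨φ, hφ⟩ := exists_aeval_of_commute hA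
  have hs := sameSymbol_of_mem_pairSubring hφ hx
  refine Prod.ext h0 (constVec_ext fun m u => coeffVec_ext fun m' => ?_)
  obtain ⟨p, hp⟩ := hs (m' - m)
  have hp0 : p = 0 := eq_zero_of_eval_intCast fun k => by rw [← (hp k).1, h0]; simp
  have := (hp m).2 u
  rw [add_sub_cancel, hp0, map_zero, map_zero, Matrix.zero_mulVec] at this
  rw [this]
  rfl

lemma fst_mem_diffOps_of_mem_pairSubring
    {x : Module.End ℂ (CoordRing l) × Module.End ℂ (Fin n → CoordRing l)}
    (hx : x ∈ pairSubring A) : x.1 ∈ diffOps ℂ (CoordRing l) := by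
  induction hx using Subring.closure_induction with
  | mem x hx =>
    rcases hx with ⟨f, rfl⟩ | ⟨k, rfl⟩
    · exact (funOp ℂ f).2
    · exact (derOp (eulerDer k)).2
  | zero => exact zero_mem _
  | one => exact one_mem _
  | add x x' _ _ hx hx' => exact add_mem hx hx'
  | neg x _ hx => exact neg_mem hx
  | mul x x' _ _ hx hx' => exact mul_mem hx hx'

lemma exists_mem_pairSubring {P : Module.End ℂ (CoordRing l)} (hP : P ∈ diffOps ℂ (CoordRing l)) :
    ∃ x ∈ pairSubring A, x.1 = P := by
  have h : eulerSubring l ≤ (pairSubring A).map (RingHom.fst _ _) := by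
    refine Subring.closure_le.2 ?_
    rintro _ (⟨f, rfl⟩ | ⟨k, rfl⟩)
    · exact ⟨funPair f, Subring.subset_closure (Or.inl ⟨f, rfl⟩), rfl⟩
    · exact ⟨(eulerMap k, covDer A k), Subring.subset_closure (Or.inr ⟨k, rfl⟩), rfl⟩
  exact h (mem_eulerSubring_of_mem_diffOps hP)

/-- A commuting family of matrices defines a `D(T)`-module structure on the trivial bundle. -/
lemma exists_action (hA : ∀ i j, Commute (A i) (A j)) :
    ∃ a : diffOps ℂ (CoordRing l) →+* Module.End ℂ (Fin n → CoordRing l),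
      (∀ f s, a (funOp ℂ f) s = f • s) ∧ ∀ k, a (derOp (eulerDer k)) = covDer A k := by
  -- The ring of pairs is the graph of the desired action: the first projection is bijective onto
  -- D(T), and its inverse followed by the second projection is the action.
  let π : pairSubring A →+* diffOps ℂ (CoordRing l) :=
    ((RingHom.fst _ _).comp (pairSubring A).subtype).codRestrict (diffOps ℂ (CoordRing l))
      fun x => fst_mem_diffOps_of_mem_pairSubring x.2
  have hinj : Function.Injective π := by
    rw [injective_iff_map_eq_zero]
    intro x hx
    exact Subtype.ext (eq_zero_of_mem_pairSubring hA x.2 (congrArg Subtype.val hx))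
  have hsurj : Function.Surjective π := fun P => by
    obtain ⟨x, hx, hxP⟩ := exists_mem_pairSubring (A := A) P.2
    exact ⟨⟨x, hx⟩, Subtype.ext hxP⟩
  let e := RingEquiv.ofBijective π ⟨hinj, hsurj⟩
  have he : ∀ x : pairSubring A, e.symm (π x) = x := fun x => e.symm_apply_apply x
  refine ⟨((RingHom.snd _ _).comp (pairSubring A).subtype).comp e.symm.toRingHom,
    fun f s => ?_, fun k => ?_⟩
  · have : funOp ℂ f = π ⟨funPair f, Subring.subset_closure (Or.inl ⟨f, rfl⟩)⟩ := rfl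
    change (e.symm (funOp ℂ f)).1.2 s = _
    rw [this, he]
    rfl
  · have : derOp (eulerDer k) =
      π ⟨(eulerMap k, covDer A k), Subring.subset_closure (Or.inr ⟨k, rfl⟩)⟩ := rfl
    change (e.symm (derOp (eulerDer k))).1.2 = _
    rw [this, he]

/-- A property of differential operators that holds for functions and Euler operators and defines
a subring holds for all differential operators. -/
lemma diffOps_subring_eq_top (S : Subring (diffOps ℂ (CoordRing l)))
    (hf : ∀ f, funOp ℂ f ∈ S) (hd : ∀ k, derOp (eulerDer k) ∈ S) (P : diffOps ℂ (CoordRing l)) :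
    P ∈ S := by
  have h : eulerSubring l ≤ S.map (diffOps ℂ (CoordRing l)).val.toRingHom := by
    refine Subring.closure_le.2 ?_
    rintro _ (⟨f, rfl⟩ | ⟨k, rfl⟩)
    · exact ⟨funOp ℂ f, hf f, rfl⟩
    · exact ⟨derOp (eulerDer k), hd k, rfl⟩
  obtain ⟨Q, hQ, hQP⟩ := h (mem_eulerSubring_of_mem_diffOps P.2)
  rwa [show P = Q from Subtype.ext hQP.symm]

end Action

/-! ### Logarithmic 1-forms, invariant vector fields and representations of Lie T. -/

section TorusForms

variable {l n : ℕ}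

/-- The invariant 1-form `dtᵢ/tᵢ` on the torus. -/
def dlog (i : Fin l) : Ω[CoordRing l⁄ℂ] :=
  (AddMonoidAlgebra.single (-Pi.single i 1) 1 : CoordRing l) •
    KaehlerDifferential.D ℂ (CoordRing l) (AddMonoidAlgebra.single (Pi.single i 1) 1)

/-- The logarithmic differential t^(-m) d(t^m) is additive in m, so the generators of the exponent
lattice suffice. -/
lemma D_monomial (m : Fin l → ℤ) :
    KaehlerDifferential.D ℂ (CoordRing l) (AddMonoidAlgebra.single m 1) =
      (AddMonoidAlgebra.single m 1 : CoordRing l) •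
        ∑ i, (algebraMap ℂ (CoordRing l) (m i)) • dlog i := by
  induction m using exponent_induction with
  | h0 =>
    rw [← AddMonoidAlgebra.one_def, Derivation.map_one_eq_zero]
    simp
  | hs i =>
    have : ∀ j, (algebraMap ℂ (CoordRing l) ((Pi.single i (1 : ℤ) : Fin l → ℤ) j)) • dlog j =
        if j = i then dlog j else 0 := by
      intro j
      by_cases h : j = i
      · subst h; rw [Pi.single_eq_same, Int.cast_one, map_one, one_smul, if_pos rfl]
      · simp [h]
    rw [Finset.sum_congr rfl fun j _ => this j, Finset.sum_ite_eq', if_pos (Finset.mem_univ i), dlog,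
      smul_smul, AddMonoidAlgebra.single_mul_single, add_neg_cancel, one_mul,
      ← AddMonoidAlgebra.one_def, one_smul]
  | ha m m' hm hm' =>
    have h : (AddMonoidAlgebra.single (m + m') 1 : CoordRing l) =
        AddMonoidAlgebra.single m 1 * AddMonoidAlgebra.single m' 1 := by
      rw [AddMonoidAlgebra.single_mul_single, one_mul]
    rw [h, Derivation.leibniz, hm, hm']
    simp only [Pi.add_apply, Int.cast_add, map_add, add_smul, Finset.sum_add_distrib, smul_add,
      smul_smul]
    rw [mul_comm (AddMonoidAlgebra.single m' (1 : ℂ)), add_comm]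
  | hn m hm =>
    have h : (AddMonoidAlgebra.single m 1 : CoordRing l) * AddMonoidAlgebra.single (-m) 1 = 1 := by
      rw [AddMonoidAlgebra.single_mul_single, one_mul, add_neg_cancel, AddMonoidAlgebra.one_def]
    have h1 := congrArg (KaehlerDifferential.D ℂ (CoordRing l)) h
    rw [Derivation.leibniz, Derivation.map_one_eq_zero, hm, smul_smul,
      mul_comm (AddMonoidAlgebra.single (-m) (1 : ℂ)), h, one_smul] at h1
    have h2 := congrArg ((AddMonoidAlgebra.single (-m) 1 : CoordRing l) • ·) (eq_neg_of_add_eq_zero_left h1)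
    simp only [smul_smul] at h2
    rw [mul_comm (AddMonoidAlgebra.single (-m) (1 : ℂ)), h, one_smul] at h2
    rw [h2]
    simp only [Pi.neg_apply, Int.cast_neg, map_neg, neg_smul, Finset.sum_neg_distrib]

/-- The differential of a function in the basis `dtᵢ/tᵢ`. -/
lemma D_eq_sum (f : CoordRing l) :
    KaehlerDifferential.D ℂ (CoordRing l) f = ∑ i, eulerDer i f • dlog i := by
  have h : (KaehlerDifferential.D ℂ (CoordRing l)).toLinearMap =
      ∑ i, ((LinearMap.toSpanSingleton (CoordRing l) _ (dlog i)).restrictScalars ℂ).comp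
        (eulerDer i).toLinearMap := by
    refine endomorphism_ext fun m => ?_
    have h1 := D_monomial m
    rw [LinearMap.sum_apply]
    refine h1.trans ?_
    rw [Finset.smul_sum]
    refine Finset.sum_congr rfl fun i _ => ?_
    change _ = eulerDer i (AddMonoidAlgebra.single m 1) • dlog i
    rw [eulerDer_single]
    rw [smul_smul]
    congr 1
    rw [mul_comm, ← Algebra.smul_def, AddMonoidAlgebra.smul_single, smul_eq_mul]
  have := LinearMap.congr_fun h f
  simpa [LinearMap.sum_apply] using this

/-- A 1-form on the torus in the basis `dtᵢ/tᵢ`. -/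
lemma form_eq_sum (ω : Ω[CoordRing l⁄ℂ]) :
    ω = ∑ i, (eulerDer i).liftKaehlerDifferential ω • dlog i := by
  have h : (LinearMap.id : Ω[CoordRing l⁄ℂ] →ₗ[CoordRing l] _) =
      ∑ i, (LinearMap.toSpanSingleton (CoordRing l) _ (dlog i)).comp
        (eulerDer i).liftKaehlerDifferential := by
    apply Derivation.liftKaehlerDifferential_unique
    ext f
    simpa [LinearMap.sum_apply] using D_eq_sum f
  have := LinearMap.congr_fun h ω
  simpa [LinearMap.sum_apply] using this

lemma lift_dlog (v : Derivation ℂ (CoordRing l) (CoordRing l)) (i : Fin l) :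
    v.liftKaehlerDifferential (dlog i) = AddMonoidAlgebra.single (-Pi.single i 1) 1 *
      v (AddMonoidAlgebra.single (Pi.single i 1) 1) := by
  rw [dlog, map_smul, Derivation.liftKaehlerDifferential_comp_D, smul_eq_mul]

lemma lift_eulerDer_dlog (j i : Fin l) :
    (eulerDer j).liftKaehlerDifferential (dlog i) = if i = j then 1 else 0 := by
  rw [lift_dlog, eulerDer_single, AddMonoidAlgebra.single_mul_single, neg_add_cancel]
  by_cases h : i = j
  · subst h; simp [AddMonoidAlgebra.one_def]
  · simp [h, Ne.symm h]

lemma derivation_apply_eq_sum (v : Derivation ℂ (CoordRing l) (CoordRing l)) (f : CoordRing l) :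
    v f = ∑ i, v.liftKaehlerDifferential (dlog i) * eulerDer i f := by
  rw [← Derivation.liftKaehlerDifferential_comp_D v f, D_eq_sum, map_sum]
  refine Finset.sum_congr rfl fun i _ => ?_
  rw [map_smul, smul_eq_mul, mul_comm]

lemma translate_monomial_mul (t : Torus l) (m : Fin l → ℤ) :
    translate t (AddMonoidAlgebra.single (-m) 1) * translate t (AddMonoidAlgebra.single m 1) = 1 := by
  rw [← map_mul, AddMonoidAlgebra.single_mul_single, neg_add_cancel, one_mul,
    ← AddMonoidAlgebra.one_def, map_one]

/-- Translation scales t_i⁻¹ and dt_i by inverse constants, so dt_i/t_i is invariant. -/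
lemma pullbackForm_smul_dlog (t : Torus l) (f : CoordRing l) (i : Fin l) :
    pullbackForm (translate t) (f • dlog i) = translate t f • dlog i := by
  have h : translate t (AddMonoidAlgebra.single (Pi.single i 1) 1 : CoordRing l) =
      monomialValue t (Pi.single i 1) • AddMonoidAlgebra.single (Pi.single i 1) 1 := by
    rw [translate_single]; simp
  have h' := translate_monomial_mul t (Pi.single i 1)
  rw [h, mul_smul_comm, ← smul_mul_assoc] at h'
  have h2 : monomialValue t (Pi.single i 1) •
      translate t (AddMonoidAlgebra.single (-Pi.single i 1) 1 : CoordRing l) =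
      AddMonoidAlgebra.single (-Pi.single i 1) 1 := by
    have h3 := congrArg (· * (AddMonoidAlgebra.single (-Pi.single i 1) 1 : CoordRing l)) h'
    simpa only [mul_assoc, AddMonoidAlgebra.single_mul_single, add_neg_cancel, one_mul, mul_one,
      ← AddMonoidAlgebra.one_def] using h3
  rw [dlog, smul_smul, pullbackForm_smul_D, map_mul, h, Derivation.map_smul, smul_algebra_smul_comm,
    ← smul_assoc, ← mul_smul_comm, h2, smul_smul]

lemma pullbackForm_sum_dlog (t : Torus l) (f : Fin l → CoordRing l) :
    pullbackForm (translate t) (∑ i, f i • dlog i) = ∑ i, translate t (f i) • dlog i := by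
  have h0 : pullbackForm (translate t) (0 : Ω[CoordRing l⁄ℂ]) = 0 := by
    simpa using pullbackForm_smul_D (translate t) (0 : CoordRing l) 0
  let F : Ω[CoordRing l⁄ℂ] →+ Ω[CoordRing l⁄ℂ] :=
    { toFun := pullbackForm (translate t), map_zero' := h0
      map_add' := pullbackForm_add (translate t) }
  change F _ = _
  rw [map_sum]
  exact Finset.sum_congr rfl fun i _ => pullbackForm_smul_dlog t (f i) i

lemma lift_eulerDer_sum_dlog (f : Fin l → CoordRing l) (j : Fin l) :
    (eulerDer j).liftKaehlerDifferential (∑ i, f i • dlog i) = f j := by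
  rw [map_sum]
  simp [lift_eulerDer_dlog]

lemma coeff_translate (t : Torus l) (f : CoordRing l) (m : Fin l → ℤ) :
    (translate t f).coeff m = f.coeff m * monomialValue t m := by
  induction f using AddMonoidAlgebra.induction_linear with
  | zero => simp
  | add f g hf hg => simp [hf, hg, add_mul]
  | single m' c =>
    rw [translate_single]
    by_cases h : m' = m
    · subst h; simp
    · simp [h]

/-- A translation-invariant function on the torus is constant. -/
lemma eq_algebraMap_of_translate {f : CoordRing l} (h : ∀ t : Torus l, translate t f = f) :
    f = algebraMap ℂ (CoordRing l) (f.coeff 0) := by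
  ext m
  by_cases hm : m = 0
  · subst hm; simp
  · obtain ⟨i, hi⟩ := Function.ne_iff.1 hm
    -- At the point with i-th coordinate 2 and all others 1, t^m has value 2^(m_i) ≠ 1, so
    -- invariance kills the coefficient of t^m.
    let t : Torus l := Pi.mulSingle i (Units.mk0 2 two_ne_zero)
    have ht : monomialValue t m ≠ 1 := by
      have h1 : monomialValue t m = (2 : ℂ) ^ m i := by
        rw [monomialValue, Finset.prod_eq_single i]
        · simp [t]
        · intro j _ hj; simp [t, hj]
        · simp
      rw [h1]
      intro h2
      have h3 := congrArg norm h2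
      rw [norm_zpow, norm_one] at h3
      simp only [Complex.norm_ofNat] at h3
      exact hi (by simpa using (zpow_eq_one_iff_right₀ (by norm_num) (by norm_num)).1 h3)
    have h1 := congrArg (fun g : CoordRing l => g.coeff m) (h t)
    simp only [coeff_translate] at h1
    have h2 : f.coeff m = 0 := by
      by_contra h3
      exact ht (mul_left_cancel₀ h3 (by rw [h1, mul_one]))
    rw [h2]
    simp [Ne.symm hm]

/-- The coefficients of an invariant form are constant. -/
lemma lift_eulerDer_eq_algebraMap {ω : Ω[CoordRing l⁄ℂ]}
    (h : ∀ t : Torus l, pullbackForm (translate t) ω = ω) (i : Fin l) :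
    (eulerDer i).liftKaehlerDifferential ω =
      algebraMap ℂ (CoordRing l) (((eulerDer i).liftKaehlerDifferential ω).coeff 0) := by
  refine eq_algebraMap_of_translate fun t => ?_
  have h1 := h t
  rw [form_eq_sum ω, pullbackForm_sum_dlog] at h1
  have h2 := congrArg (eulerDer i).liftKaehlerDifferential h1
  rwa [lift_eulerDer_sum_dlog, lift_eulerDer_sum_dlog] at h2

/-- The coordinate of an invariant vector field along `tᵢ∂/∂tᵢ`. -/
def lieCoord (i : Fin l) : lieTorus l →ₗ[ℂ] ℂ where
  toFun v := (v.1.liftKaehlerDifferential (dlog i)).coeff 0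
  map_add' v w := by simp [lift_dlog]
  map_smul' c v := by simp [lift_dlog]

/-- For invariant v the function t_i⁻¹ v(t_i) is translation invariant, since the two scalings
cancel; it is therefore its constant term. -/
lemma lift_dlog_of_mem_lieTorus (v : lieTorus l) (i : Fin l) :
    v.1.liftKaehlerDifferential (dlog i) = algebraMap ℂ (CoordRing l) (lieCoord i v) := by
  refine eq_algebraMap_of_translate fun t => ?_
  rw [lift_dlog, map_mul, ← v.2 t, translate_single, translate_single]
  have h : ∀ (m : Fin l → ℤ) (c : ℂ), (AddMonoidAlgebra.single m c : CoordRing l) =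
      c • AddMonoidAlgebra.single m 1 := fun m c => by simp
  rw [h _ (1 * _), h (Pi.single i 1) (1 * _), Derivation.map_smul, smul_mul_smul_comm, one_mul, one_mul,
    ← monomialValue_add, neg_add_cancel, monomialValue_zero, one_smul]

lemma lieTorus_eq_sum (v : lieTorus l) : v = ∑ i, lieCoord i v • eulerLie i := by
  apply Subtype.ext
  apply Derivation.ext
  intro f
  have h : ((∑ i, lieCoord i v • eulerLie i : lieTorus l) : Derivation ℂ (CoordRing l) (CoordRing l)) =
      ∑ i, lieCoord i v • eulerDer i := by
    rw [AddSubmonoidClass.coe_finsetSum]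
    rfl
  rw [h, derivation_apply_eq_sum]
  simp only [lift_dlog_of_mem_lieTorus]
  have h2 : ∀ s : Finset (Fin l), (∑ i ∈ s, lieCoord i v • eulerDer i) f =
      ∑ i ∈ s, (lieCoord i v • eulerDer i) f := fun s => by
    induction s using Finset.induction_on with
    | empty => simp
    | insert a s ha ih => rw [Finset.sum_insert ha, Finset.sum_insert ha, ← ih]; rfl
  rw [h2]
  exact Finset.sum_congr rfl fun i _ => by rw [Derivation.smul_apply, Algebra.smul_def]

lemma lieCoord_eulerLie (i j : Fin l) : lieCoord i (eulerLie j) = if i = j then 1 else 0 := by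
  change ((eulerDer j).liftKaehlerDifferential (dlog i)).coeff 0 = _
  rw [lift_eulerDer_dlog]
  by_cases h : i = j <;> simp [h, AddMonoidAlgebra.one_def]

lemma lieTorus_lie (v w : lieTorus l) : ⁅v, w⁆ = 0 := by
  rw [lieTorus_eq_sum v, lieTorus_eq_sum w]
  simp only [lie_sum, sum_lie, smul_lie, lie_smul, eulerLie_lie, smul_zero, Finset.sum_const_zero]

lemma lieRep_apply (ρ : LieRep l n) (v : lieTorus l) :
    ρ v = ∑ i, lieCoord i v • ρ (eulerLie i) := by
  conv_lhs => rw [lieTorus_eq_sum v]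
  rw [map_sum]
  exact Finset.sum_congr rfl fun i _ => by rw [map_smul]

lemma lieRep_commute (ρ : LieRep l n) (i j : Fin l) :
    Commute (ρ (eulerLie i)) (ρ (eulerLie j)) := by
  have h : ⁅ρ (eulerLie i), ρ (eulerLie j)⁆ = 0 := by rw [← LieHom.map_lie, eulerLie_lie, map_zero]
  rwa [Ring.lie_def, sub_eq_zero] at h

/-- Commuting matrices define a representation of `Lie T`. -/
lemma exists_lieRep {A : Fin l → Matrix (Fin n) (Fin n) ℂ} (hA : ∀ i j, Commute (A i) (A j)) :
    ∃ ρ : LieRep l n, ∀ i, ρ (eulerLie i) = A i := by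
  let L : lieTorus l →ₗ[ℂ] Matrix (Fin n) (Fin n) ℂ :=
    ∑ i, (LinearMap.toSpanSingleton ℂ _ (A i)).comp (lieCoord i)
  have hL : ∀ v, L v = ∑ i, lieCoord i v • A i := fun v => by simp [L, LinearMap.sum_apply]
  refine ⟨{ L with map_lie' := ?_ }, fun i => ?_⟩
  · intro v w
    change L ⁅v, w⁆ = ⁅L v, L w⁆
    rw [lieTorus_lie, map_zero, Ring.lie_def, hL, hL, eq_comm, sub_eq_zero]
    exact Commute.sum_left _ _ _ fun i _ => Commute.sum_right _ _ _ fun j _ =>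
      ((hA i j).smul_left _).smul_right _
  · change L (eulerLie i) = A i
    rw [hL]
    simp [lieCoord_eulerLie]

/-! ### The connection form of a commuting family of matrices -/

/-- The connection form `∑ₖ Aₖ dt_k/t_k`. -/
def torusForm (A : Fin l → Matrix (Fin n) (Fin n) ℂ) : Matrix (Fin n) (Fin n) Ω[CoordRing l⁄ℂ] :=
  fun i j => ∑ k, algebraMap ℂ (CoordRing l) (A k i j) • dlog k

lemma torusForm_invariant (A : Fin l → Matrix (Fin n) (Fin n) ℂ) (t : Torus l) :
    (torusForm A).map (pullbackForm (translate t)) = torusForm A := by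
  ext i j
  rw [Matrix.map_apply, torusForm, pullbackForm_sum_dlog]
  simp only [AlgHom.commutes]

lemma evalForm_torusForm (A : Fin l → Matrix (Fin n) (Fin n) ℂ)
    (v : Derivation ℂ (CoordRing l) (CoordRing l)) (i j : Fin n) :
    evalForm (torusForm A) v i j =
      ∑ k, v.liftKaehlerDifferential (dlog k) * algebraMap ℂ (CoordRing l) (A k i j) := by
  rw [evalForm, Matrix.map_apply, torusForm, map_sum]
  exact Finset.sum_congr rfl fun k _ => by rw [map_smul, smul_eq_mul, mul_comm]

lemma wedge_sum_left {ι : Type*} (s : Finset ι) (f : ι → Ω[CoordRing l⁄ℂ]) (η : Ω[CoordRing l⁄ℂ]) :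
    wedge (∑ i ∈ s, f i) η = ∑ i ∈ s, wedge (f i) η :=
  map_sum (AddMonoidHom.mk' (wedge · η) fun a b => wedge_add_left a b η) f s

lemma wedge_sum_right {ι : Type*} (s : Finset ι) (f : ι → Ω[CoordRing l⁄ℂ]) (η : Ω[CoordRing l⁄ℂ]) :
    wedge η (∑ i ∈ s, f i) = ∑ i ∈ s, wedge η (f i) :=
  map_sum (AddMonoidHom.mk' (wedge η ·) fun a b => wedge_add_right η a b) f s

/-- Both d(t_k⁻¹) and dt_k are multiples of dt_k/t_k, so their wedge product vanishes. -/
lemma extDeriv_const_smul_dlog (c : ℂ) (k : Fin l) :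
    extDeriv ℂ (CoordRing l) (algebraMap ℂ (CoordRing l) c • dlog k) = 0 := by
  rw [dlog, smul_smul, extDeriv_smul_D, ← Algebra.smul_def, Derivation.map_smul, D_monomial,
    D_monomial]
  have h : ∀ c : ℤ, ∑ i, algebraMap ℂ (CoordRing l) ((Pi.single k c : Fin l → ℤ) i) • dlog i =
      algebraMap ℂ (CoordRing l) c • dlog k := by
    intro c
    rw [Finset.sum_eq_single k]
    · simp
    · intro j _ hj; simp [hj]
    · simp
  rw [← Pi.single_neg, h, h, ← algebraMap_smul (CoordRing l) c, wedge_smul_left, wedge_smul_left,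
    wedge_smul_left, wedge_smul_right, wedge_smul_right, wedge_self]
  simp

/-- Each entry of the form is closed, and α ∧ α pairs the coefficients A_p A_q, symmetric in p and
q, with the antisymmetric dlog p ∧ dlog q. -/
lemma torusForm_flat {A : Fin l → Matrix (Fin n) (Fin n) ℂ} (hA : ∀ i j, Commute (A i) (A j)) :
    IsFlat (torusForm A) := by
  intro i j
  have h1 : extDeriv ℂ (CoordRing l) (torusForm A i j) = 0 := by
    rw [torusForm, map_sum]
    exact Finset.sum_eq_zero fun k _ => extDeriv_const_smul_dlog _ k
  have h2 : ∑ s, wedge (torusForm A i s) (torusForm A s j) =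
      ∑ p, ∑ q, algebraMap ℂ (CoordRing l) ((A p * A q) i j) • wedge (dlog p) (dlog q) := by
    have h : ∀ s, wedge (torusForm A i s) (torusForm A s j) = ∑ p, ∑ q,
        (algebraMap ℂ (CoordRing l) (A p i s) * algebraMap ℂ (CoordRing l) (A q s j)) •
          wedge (dlog p) (dlog q) := fun s => by
      rw [torusForm, torusForm, wedge_sum_left]
      refine Finset.sum_congr rfl fun p _ => ?_
      rw [wedge_sum_right]
      refine Finset.sum_congr rfl fun q _ => ?_
      rw [wedge_smul_left, wedge_smul_right, smul_smul]
    simp only [h, Matrix.mul_apply, map_sum, Finset.sum_smul, map_mul]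
    rw [Finset.sum_comm]
    refine Finset.sum_congr rfl fun p _ => ?_
    rw [Finset.sum_comm]
  rw [h1, h2, zero_add]
  set S := ∑ p, ∑ q, algebraMap ℂ (CoordRing l) ((A p * A q) i j) • wedge (dlog p) (dlog q)
    with hS
  have h3 : S = -S := by
    conv_lhs => rw [hS, Finset.sum_comm]
    rw [hS, ← Finset.sum_neg_distrib]
    refine Finset.sum_congr rfl fun p _ => ?_
    rw [← Finset.sum_neg_distrib]
    refine Finset.sum_congr rfl fun q _ => ?_
    rw [wedge_swap (dlog p) (dlog q), smul_neg, (hA q p).eq]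
  have h4 : (algebraMap ℂ (CoordRing l) 2) • S = 0 := by
    rw [map_ofNat, ofNat_smul_eq_nsmul, two_nsmul]
    nth_rw 2 [h3]
    exact add_neg_cancel S
  have h5 := congrArg ((algebraMap ℂ (CoordRing l) 2⁻¹) • ·) h4
  simpa only [smul_smul, ← map_mul, inv_mul_cancel₀ (two_ne_zero (α := ℂ)), map_one, one_smul,
    smul_zero] using h5

end TorusForms

/-! ### Classification of invariant D-modules by monodromy. -/

section Classification

variable {l n : ℕ}

/-! ### Invariant D-modules and representations -/

lemma derOp_mul_funOp (v : Derivation ℂ (CoordRing l) (CoordRing l)) (f : CoordRing l) :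
    derOp v * funOp ℂ f = funOp ℂ f * derOp v + funOp ℂ (v f) := by
  apply Subtype.ext
  refine LinearMap.ext fun x => ?_
  change v (f * x) = f * v x + v f * x
  rw [Derivation.leibniz, smul_eq_mul, smul_eq_mul, mul_comm x]

lemma section_eq_sum (s : Fin n → CoordRing l) :
    s = ∑ j, s j • (Pi.single j 1 : Fin n → CoordRing l) := by
  funext i
  simp [Finset.sum_apply, Pi.single_apply]

/-- The Leibniz rule in D(T) extends the prescribed values on basis vectors: a vector field v acts
as the connection v + α(v). -/
lemma action_derOp_apply (M : InvariantDModule l n)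
    (v : Derivation ℂ (CoordRing l) (CoordRing l)) (s : Fin n → CoordRing l) :
    M.action (derOp v) s = (fun i => v (s i)) + (evalForm M.form v).mulVec s := by
  have h : ∀ (f : CoordRing l) (j : Fin n), M.action (derOp v) (f • Pi.single j 1) =
      f • (fun i => evalForm M.form v i j) + v f • Pi.single j 1 := by
    intro f j
    rw [← M.action_funOp, ← Module.End.mul_apply, ← map_mul, derOp_mul_funOp, map_add, map_mul,
      LinearMap.add_apply, Module.End.mul_apply, M.action_funOp, M.action_funOp, M.action_derOp]
  conv_lhs => rw [section_eq_sum s]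
  rw [map_sum, Finset.sum_congr rfl fun j _ => h (s j) j, Finset.sum_add_distrib, add_comm]
  congr 1
  · exact (section_eq_sum fun i => v (s i)).symm
  · funext i
    simp [Finset.sum_apply, Matrix.mulVec, dotProduct, mul_comm]

lemma action_eulerDer_of_evalForm {M : InvariantDModule l n} {A : Fin l → Matrix (Fin n) (Fin n) ℂ}
    {k : Fin l} (h : evalForm M.form (eulerDer k) = (A k).map (algebraMap ℂ (CoordRing l))) :
    M.action (derOp (eulerDer k)) = covDer A k := by
  refine LinearMap.ext fun s => ?_
  rw [action_derOp_apply, h]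
  rfl

lemma InvariantDModule.action_eulerDer {M : InvariantDModule l n} {ρ : LieRep l n}
    (h : IsFormOf M.form ρ) (k : Fin l) :
    M.action (derOp (eulerDer k)) = covDer (fun k => ρ (eulerLie k)) k :=
  action_eulerDer_of_evalForm (h (eulerLie k))

lemma form_eq_of_evalForm {α β : Matrix (Fin n) (Fin n) Ω[CoordRing l⁄ℂ]}
    (h : ∀ k, evalForm α (eulerDer k) = evalForm β (eulerDer k)) : α = β := by
  ext i j
  rw [form_eq_sum (α i j), form_eq_sum (β i j)]
  refine Finset.sum_congr rfl fun k _ => ?_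
  congr 1
  exact congrFun (congrFun (h k) i) j

/-- The action carries no extra data: the form fixes it on functions and Euler operators, which
generate D(T). -/
lemma InvariantDModule.eq_of_form_eq {M N : InvariantDModule l n} (h : M.form = N.form) :
    M = N := by
  have ha : M.action = N.action := by
    ext1 P
    refine diffOps_subring_eq_top (RingHom.eqLocus M.action N.action) (fun f => ?_) (fun k => ?_) P
    · refine LinearMap.ext fun s => ?_
      rw [M.action_funOp, N.action_funOp]
    · refine LinearMap.ext fun s => ?_
      rw [action_derOp_apply, action_derOp_apply, h]
  cases M
  cases N
  subst h
  subst ha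
  rfl

lemma InvariantDModule.eq_of_isFormOf {M N : InvariantDModule l n} {ρ : LieRep l n}
    (hM : IsFormOf M.form ρ) (hN : IsFormOf N.form ρ) : M = N :=
  eq_of_form_eq (form_eq_of_evalForm fun k => (hM (eulerLie k)).trans (hN (eulerLie k)).symm)

lemma algebraMap_coordRing_injective : Function.Injective (algebraMap ℂ (CoordRing l)) :=
  FaithfulSMul.algebraMap_injective ℂ (CoordRing l)

lemma map_algebraMap_injective : Function.Injective
    fun C : Matrix (Fin n) (Fin n) ℂ => C.map (algebraMap ℂ (CoordRing l)) :=
  Matrix.map_injective algebraMap_coordRing_injective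

lemma isFormOf_unique {α : Matrix (Fin n) (Fin n) Ω[CoordRing l⁄ℂ]} {ρ σ : LieRep l n}
    (hρ : IsFormOf α ρ) (hσ : IsFormOf α σ) : ρ = σ := by
  refine LieHom.ext fun v => ?_
  exact map_algebraMap_injective ((hρ v).symm.trans (hσ v))

lemma isFormOf_of_eulerDer {α : Matrix (Fin n) (Fin n) Ω[CoordRing l⁄ℂ]} {ρ : LieRep l n}
    (h : ∀ k, evalForm α (eulerDer k) = (ρ (eulerLie k)).map (algebraMap ℂ (CoordRing l))) :
    IsFormOf α ρ := by
  have hα : α = torusForm fun k => ρ (eulerLie k) := by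
    refine form_eq_of_evalForm fun k => ?_
    rw [h]
    ext1 i j
    rw [evalForm_torusForm]
    simp [lift_eulerDer_dlog]
  intro v
  ext1 i j
  rw [hα, evalForm_torusForm, lieRep_apply ρ v, Matrix.map_apply, Matrix.sum_apply, map_sum]
  refine Finset.sum_congr rfl fun k _ => ?_
  rw [lift_dlog_of_mem_lieTorus, ← map_mul]
  rfl

/-- Every representation of `Lie T` determines an invariant D-module. -/
lemma exists_invariantDModule (ρ : LieRep l n) :
    ∃ M : InvariantDModule l n, IsFormOf M.form ρ := by
  set A : Fin l → Matrix (Fin n) (Fin n) ℂ := fun k => ρ (eulerLie k) with hA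
  have hcomm : ∀ i j, Commute (A i) (A j) := lieRep_commute ρ
  obtain ⟨a, haf, had⟩ := exists_action hcomm
  -- The action is known only on functions and Euler operators; writing v = ∑ f_k θ_k gives its
  -- value on every vector field.
  have hder : ∀ v : Derivation ℂ (CoordRing l) (CoordRing l),
      derOp v = ∑ k, funOp ℂ (v.liftKaehlerDifferential (dlog k)) * derOp (eulerDer k) := by
    intro v
    apply Subtype.ext
    refine LinearMap.ext fun f => ?_
    rw [AddSubmonoidClass.coe_finsetSum, LinearMap.sum_apply]
    exact derivation_apply_eq_sum v f
  refine ⟨⟨torusForm A, torusForm_flat hcomm, torusForm_invariant A, a, haf, ?_⟩, ?_⟩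
  · intro v j
    funext i
    rw [evalForm_torusForm, hder, map_sum, LinearMap.sum_apply, Finset.sum_apply]
    refine Finset.sum_congr rfl fun k _ => ?_
    rw [map_mul, Module.End.mul_apply, haf, had, covDer_apply, Pi.smul_apply, smul_eq_mul,
      Pi.add_apply]
    congr 1
    have h0 : eulerMap k ((Pi.single j 1 : Fin n → CoordRing l) i) = 0 := by
      by_cases hij : i = j
      · subst hij
        rw [Pi.single_eq_same, AddMonoidAlgebra.one_def, eulerMap_single]
        simp
      · simp [hij]
    rw [h0, zero_add, Matrix.mulVec_single_one]
    rfl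
  · refine isFormOf_of_eulerDer fun k => ?_
    ext1 i j
    rw [evalForm_torusForm]
    simp [lift_eulerDer_dlog, hA]

/-- On constant sections, the part of degree 0, θ_k + A_k acts as A_k. -/
lemma commute_of_commute_covDer {A : Fin l → Matrix (Fin n) (Fin n) ℂ} {i j : Fin l}
    (h : Commute (covDer A i) (covDer A j)) : Commute (A i) (A j) := by
  refine Matrix.ext_of_mulVec_single fun k => ?_
  have h1 := LinearMap.congr_fun h.eq (constVec 0 (Pi.single k 1))
  simp only [Module.End.mul_apply, covDer_constVec, Pi.zero_apply, Int.cast_zero, zero_smul, zero_add,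
    Matrix.mulVec_mulVec] at h1
  simpa only [coeffVec_constVec_self] using congrArg (coeffVec · 0) h1

/-- Every invariant D-module comes from a representation of `Lie T`. -/
lemma InvariantDModule.exists_isFormOf (M : InvariantDModule l n) :
    ∃ ρ : LieRep l n, IsFormOf M.form ρ := by
  let A : Fin l → Matrix (Fin n) (Fin n) ℂ := fun k i j => (evalForm M.form (eulerDer k) i j).coeff 0
  have hA : ∀ k, evalForm M.form (eulerDer k) = (A k).map (algebraMap ℂ (CoordRing l)) := by
    intro k
    ext1 i j
    exact lift_eulerDer_eq_algebraMap (fun t => congrFun (congrFun (M.invariant t) i) j) k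
  -- The Euler operators commute in D(T), so their images θ_k + A_k under the action commute.
  have hcomm : ∀ i j, Commute (A i) (A j) := by
    intro i j
    apply commute_of_commute_covDer
    rw [← action_eulerDer_of_evalForm (hA i), ← action_eulerDer_of_evalForm (hA j)]
    have h : Commute (derOp (eulerDer i)) (derOp (eulerDer j)) := by
      apply Subtype.ext
      refine endomorphism_ext fun m => ?_
      change eulerDer i (eulerDer j _) = eulerDer j (eulerDer i _)
      simp only [eulerDer_single]
      congr 1
      ring
    exact h.map M.action
  obtain ⟨ρ, hρ⟩ := exists_lieRep hcomm
  exact ⟨ρ, isFormOf_of_eulerDer fun k => by rw [hA, hρ]⟩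

/-! ### Gauge transformations -/

/-- The matrix of functions `G` is a gauge transformation from the connection with matrices `A` to
the connection with matrices `B`. -/
def IsGauge (A B : Fin l → Matrix (Fin n) (Fin n) ℂ) (G : Matrix (Fin n) (Fin n) (CoordRing l)) :
    Prop :=
  ∀ k, G.map (eulerMap k) + (B k).map (algebraMap ℂ (CoordRing l)) * G =
    G * (A k).map (algebraMap ℂ (CoordRing l))

lemma eulerMap_mul (k : Fin l) (f g : CoordRing l) :
    eulerMap k (f * g) = eulerMap k f * g + f * eulerMap k g := by
  have := (eulerDer k).leibniz f g
  rw [smul_eq_mul, smul_eq_mul, mul_comm g, add_comm] at this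
  exact this

lemma map_eulerMap_mul (k : Fin l) (G H : Matrix (Fin n) (Fin n) (CoordRing l)) :
    (G * H).map (eulerMap k) = G.map (eulerMap k) * H + G * H.map (eulerMap k) := by
  ext1 i j
  simp only [Matrix.map_apply, Matrix.mul_apply, Matrix.add_apply, map_sum, eulerMap_mul,
    Finset.sum_add_distrib]

lemma eulerMap_algebraMap (k : Fin l) (c : ℂ) : eulerMap k (algebraMap ℂ (CoordRing l) c) = 0 :=
  (eulerDer k).map_algebraMap c

lemma map_eulerMap_const (k : Fin l) (C : Matrix (Fin n) (Fin n) ℂ) :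
    (C.map (algebraMap ℂ (CoordRing l))).map (eulerMap k) = 0 := by
  ext1 i j
  exact eulerMap_algebraMap k _

/-- Two families of matrices are gauge equivalent if there is an invertible gauge transformation
between the connections they define. -/
def GaugeEquiv (A B : Fin l → Matrix (Fin n) (Fin n) ℂ) : Prop :=
  ∃ G H : Matrix (Fin n) (Fin n) (CoordRing l), G * H = 1 ∧ H * G = 1 ∧ IsGauge A B G

lemma GaugeEquiv.refl (A : Fin l → Matrix (Fin n) (Fin n) ℂ) : GaugeEquiv A A := by
  refine ⟨1, 1, mul_one 1, mul_one 1, fun k => ?_⟩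
  have h := map_eulerMap_const (l := l) k (1 : Matrix (Fin n) (Fin n) ℂ)
  rw [Matrix.map_one _ (map_zero _) (map_one _)] at h
  rw [h, zero_add, mul_one, one_mul]

lemma GaugeEquiv.symm {A B : Fin l → Matrix (Fin n) (Fin n) ℂ} (h : GaugeEquiv A B) :
    GaugeEquiv B A := by
  obtain ⟨G, H, hGH, hHG, h⟩ := h
  refine ⟨H, G, hHG, hGH, fun k => ?_⟩
  -- Differentiating HG = 1 gives (θ_k H)G = -H(θ_k G); substituting the equation for G and
  -- multiplying by H on the right yields the equation for H.
  have h1 := map_eulerMap_mul k H G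
  have h0 := map_eulerMap_const (l := l) k (1 : Matrix (Fin n) (Fin n) ℂ)
  rw [Matrix.map_one _ (map_zero _) (map_one _)] at h0
  rw [hHG, h0, eq_sub_of_add_eq (h k)] at h1
  have h2 := congrArg (· * H) h1
  simp only [zero_mul, add_mul, mul_sub, sub_mul, mul_assoc, hGH, mul_one] at h2
  rw [← mul_assoc H G, hHG, one_mul] at h2
  rw [← sub_eq_zero, h2]
  abel

lemma GaugeEquiv.trans {A B C : Fin l → Matrix (Fin n) (Fin n) ℂ} (h : GaugeEquiv A B)
    (h' : GaugeEquiv B C) : GaugeEquiv A C := by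
  obtain ⟨G, H, hGH, hHG, h⟩ := h
  obtain ⟨G', H', hGH', hHG', h'⟩ := h'
  refine ⟨G' * G, H * H', ?_, ?_, fun k => ?_⟩
  · rw [mul_assoc, ← mul_assoc G, hGH, one_mul, hGH']
  · rw [mul_assoc, ← mul_assoc H', hHG', one_mul, hHG]
  · rw [map_eulerMap_mul, eq_sub_of_add_eq (h k), eq_sub_of_add_eq (h' k)]
    simp only [mul_sub, sub_mul, mul_assoc]
    abel

/-- Constant gauge transformations. -/
lemma GaugeEquiv.conj {A B : Fin l → Matrix (Fin n) (Fin n) ℂ} (g : GL (Fin n) ℂ)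
    (h : ∀ k, B k * g.1 = g.1 * A k) : GaugeEquiv A B := by
  have hm : ∀ C C' : Matrix (Fin n) (Fin n) ℂ, C.map (algebraMap ℂ (CoordRing l)) *
      C'.map (algebraMap ℂ (CoordRing l)) = (C * C').map (algebraMap ℂ (CoordRing l)) :=
    fun C C' => Matrix.map_mul.symm
  refine ⟨g.1.map (algebraMap ℂ (CoordRing l)), (g⁻¹).1.map (algebraMap ℂ (CoordRing l)), ?_, ?_,
    fun k => ?_⟩
  · rw [hm, Units.mul_inv, Matrix.map_one _ (map_zero _) (map_one _)]
  · rw [hm, Units.inv_mul, Matrix.map_one _ (map_zero _) (map_one _)]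
  · rw [map_eulerMap_const, zero_add, hm, hm, h]

/-- The gauge transformation `t_k^D`, for a matrix `D` with `exp (2πi D) = 1`. -/
lemma GaugeEquiv.sub {A B : Fin l → Matrix (Fin n) (Fin n) ℂ} {D : Matrix (Fin n) (Fin n) ℂ}
    (hD : NormedSpace.exp ((2 * (Real.pi : ℂ) * Complex.I) • D) = 1) (hA : ∀ j, Commute (A j) D)
    (k : Fin l) (hk : B k = A k - D) (hj : ∀ j, j ≠ k → B j = A j) : GaugeEquiv A B := by
  obtain ⟨F, p, hsum, hDp, hcomm, horth⟩ := exists_integral_spectral_decomposition hD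
  let ι : Matrix (Fin n) (Fin n) ℂ →+* Matrix (Fin n) (Fin n) (CoordRing l) :=
    (algebraMap ℂ (CoordRing l)).mapMatrix
  let τ : ℤ → CoordRing l := fun m => AddMonoidAlgebra.single (m • Pi.single k 1) 1
  have hτ : ∀ m m', τ m * τ m' = τ (m + m') := fun m m' => by
    simp only [τ, AddMonoidAlgebra.single_mul_single, add_smul, one_mul]
  have hτ0 : τ 0 = 1 := by simp only [τ, zero_smul, AddMonoidAlgebra.one_def]
  have hidem : ∀ m ∈ F, p m * p m = p m := fun m hm => by
    have h1 := congrArg (p m * ·) hsum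
    simp only [Finset.mul_sum, mul_one] at h1
    rwa [Finset.sum_eq_single m (fun m' hm' hne => horth m hm m' hm' hne.symm)
      (fun h => absurd hm h)] at h1
  -- Here t_k^D is ∑ t_k^m p_m and its inverse is ∑ t_k^(-m) p_m; orthogonality of the projections
  -- leaves only the diagonal terms.
  have hprod : ∀ f g : ℤ → ℤ, (∀ m, f m + g m = 0) →
      (∑ m ∈ F, τ (f m) • ι (p m)) * (∑ m ∈ F, τ (g m) • ι (p m)) = 1 := by
    intro f g hfg
    rw [Finset.sum_mul_sum, ← map_one ι, ← hsum, map_sum]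
    refine Finset.sum_congr rfl fun m hm => ?_
    rw [Finset.sum_eq_single m]
    · rw [smul_mul_smul_comm, ← map_mul, hidem m hm, hτ, hfg, hτ0, one_smul]
    · intro m' hm' hne
      rw [smul_mul_smul_comm, ← map_mul, horth m hm m' hm' hne.symm, map_zero, smul_zero]
    · exact fun h => absurd hm h
  set G : Matrix (Fin n) (Fin n) (CoordRing l) := ∑ m ∈ F, τ m • ι (p m) with hG
  have hGA : ∀ j, ι (A j) * G = G * ι (A j) := by
    intro j
    rw [hG, Finset.mul_sum, Finset.sum_mul]
    refine Finset.sum_congr rfl fun m _ => ?_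
    rw [mul_smul_comm, smul_mul_assoc, ← map_mul, ← map_mul, (hcomm m _ (hA j)).eq]
  have hθ : ∀ j, G.map (eulerMap j) = ∑ m ∈ F, (eulerMap j (τ m)) • ι (p m) := by
    intro j
    ext1 a b
    rw [Matrix.map_apply, hG, Matrix.sum_apply, Matrix.sum_apply, map_sum]
    refine Finset.sum_congr rfl fun m _ => ?_
    rw [Matrix.smul_apply, Matrix.smul_apply, smul_eq_mul, smul_eq_mul, eulerMap_mul]
    rw [show ι (p m) a b = algebraMap ℂ (CoordRing l) (p m a b) from rfl, eulerMap_algebraMap,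
      mul_zero, add_zero]
  refine ⟨G, ∑ m ∈ F, τ (-m) • ι (p m), hprod _ _ fun m => add_neg_cancel m,
    hprod _ _ fun m => neg_add_cancel m, fun j => ?_⟩
  change G.map (eulerMap j) + ι (B j) * G = G * ι (A j)
  by_cases h : j = k
  · subst h
    rw [hk, map_sub, sub_mul, hGA]
    -- Since D p_m = m p_m, θ_k acts on t_k^D as left multiplication by D, which cancels the -D in
    -- B_k.
    have : G.map (eulerMap j) = ι D * G := by
      rw [hθ, hG, Finset.mul_sum]
      refine Finset.sum_congr rfl fun m hm => ?_
      rw [mul_smul_comm, ← map_mul, hDp m hm]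
      have h1 : eulerMap j (τ m) = (m : ℂ) • τ m := by
        simp only [τ, eulerMap_single]
        simp
      have h2 : ι ((m : ℂ) • p m) = (m : ℂ) • ι (p m) := by
        ext1 a b
        change algebraMap ℂ (CoordRing l) ((m : ℂ) * p m a b) =
          (m : ℂ) • algebraMap ℂ (CoordRing l) (p m a b)
        rw [map_mul, Algebra.smul_def]
      rw [h1, h2, smul_assoc, smul_comm]
    rw [this]
    abel
  · rw [hj j h, hGA, hθ, Finset.sum_eq_zero, zero_add]
    intro m _
    have : eulerMap j (τ m) = 0 := by
      simp only [τ, eulerMap_single]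
      simp [h]
    rw [this, zero_smul]

/-- A commuting family is gauge equivalent to the family of chosen logarithms of its
exponentials. -/
lemma GaugeEquiv.of_log {A R : Fin l → Matrix (Fin n) (Fin n) ℂ} (hA : ∀ i j, Commute (A i) (A j))
    (hR : ∀ k, NormedSpace.exp ((2 * (Real.pi : ℂ) * Complex.I) • R k) =
      NormedSpace.exp ((2 * (Real.pi : ℂ) * Complex.I) • A k))
    (hRc : ∀ k C, Commute C (NormedSpace.exp ((2 * (Real.pi : ℂ) * Complex.I) • A k)) →
      Commute C (R k)) : GaugeEquiv A R := by
  have hexp : ∀ C k, Commute C (A k) →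
      Commute C (NormedSpace.exp ((2 * (Real.pi : ℂ) * Complex.I) • A k)) :=
    fun C k h => (h.smul_right _).exp_right
  -- Lying in the bicommutant of the j-th exponential, R_j commutes with each A_i, and then with
  -- each R_i.
  have hAR : ∀ i j, Commute (A i) (R j) := fun i j => hRc j _ (hexp _ _ (hA i j))
  have hRR : ∀ i j, Commute (R i) (R j) := fun i j => hRc j _ (hexp _ _ (hAR j i).symm)
  have hD : ∀ k, NormedSpace.exp ((2 * (Real.pi : ℂ) * Complex.I) • (A k - R k)) = 1 := by
    intro k
    have h1 : Commute ((2 * (Real.pi : ℂ) * Complex.I) • A k)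
        (-((2 * (Real.pi : ℂ) * Complex.I) • R k)) :=
      Commute.neg_right (((hAR k k).smul_left _).smul_right _)
    have h2 : Commute ((2 * (Real.pi : ℂ) * Complex.I) • R k)
        (-((2 * (Real.pi : ℂ) * Complex.I) • R k)) := Commute.neg_right (Commute.refl _)
    rw [smul_sub, sub_eq_add_neg, Matrix.exp_add_of_commute _ _ h1, ← hR,
      ← Matrix.exp_add_of_commute _ _ h2, add_neg_cancel, NormedSpace.exp_zero]
  -- The matrices are replaced one index at a time, by the gauge transformation t_k^(A_k - R_k),
  -- which leaves the other indices untouched.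
  have key : ∀ s : Finset (Fin l), GaugeEquiv A fun k => if k ∈ s then R k else A k := by
    intro s
    induction s using Finset.induction_on with
    | empty => simpa using GaugeEquiv.refl A
    | insert k s hks ih =>
      refine ih.trans (GaugeEquiv.sub (hD k) (fun j => ?_) k ?_ fun j hj => ?_)
      · split_ifs
        · exact (hAR k j).symm.sub_right (hRR j k)
        · exact (hA j k).sub_right (hAR j k)
      · simp [hks]
      · simp [hj]
  simpa using key Finset.univ

/-- Commuting families with the same exponentials are gauge equivalent. -/
lemma GaugeEquiv.of_exp_eq {A B : Fin l → Matrix (Fin n) (Fin n) ℂ}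
    (hA : ∀ i j, Commute (A i) (A j)) (hB : ∀ i j, Commute (B i) (B j))
    (h : ∀ k, NormedSpace.exp ((2 * (Real.pi : ℂ) * Complex.I) • A k) =
      NormedSpace.exp ((2 * (Real.pi : ℂ) * Complex.I) • B k)) : GaugeEquiv A B := by
  choose R hR hRc using fun k =>
    exists_two_pi_I_log (Matrix.isUnit_exp ((2 * (Real.pi : ℂ) * Complex.I) • A k))
  refine (GaugeEquiv.of_log hA hR hRc).trans
    (GaugeEquiv.of_log hB (fun k => (hR k).trans (h k)) fun k C hC => hRc k C ?_).symm
  rwa [h]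

/-- A gauge transformation intertwines the monodromy matrices. -/
lemma IsGauge.exp {A B : Fin l → Matrix (Fin n) (Fin n) ℂ}
    {G : Matrix (Fin n) (Fin n) (CoordRing l)} (h : IsGauge A B G) (k : Fin l) :
    (NormedSpace.exp ((2 * (Real.pi : ℂ) * Complex.I) • B k)).map (algebraMap ℂ (CoordRing l)) * G =
      G * (NormedSpace.exp ((2 * (Real.pi : ℂ) * Complex.I) • A k)).map
        (algebraMap ℂ (CoordRing l)) := by
  let W : (Fin l → ℤ) → Matrix (Fin n) (Fin n) ℂ := fun m => G.map fun f => f.coeff m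
  have hl : ∀ (C : Matrix (Fin n) (Fin n) ℂ) m,
      (C.map (algebraMap ℂ (CoordRing l)) * G).map (fun f => f.coeff m) = C * W m := by
    intro C m
    ext i j
    simp only [W, Matrix.map_apply, Matrix.mul_apply, AddMonoidAlgebra.coeff_sum,
      Finsupp.finsetSum_apply, ← Algebra.smul_def, AddMonoidAlgebra.coeff_smul_apply, smul_eq_mul]
  have hr : ∀ (C : Matrix (Fin n) (Fin n) ℂ) m,
      (G * C.map (algebraMap ℂ (CoordRing l))).map (fun f => f.coeff m) = W m * C := by
    intro C m
    ext i j
    simp only [W, Matrix.map_apply, Matrix.mul_apply, AddMonoidAlgebra.coeff_sum,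
      Finsupp.finsetSum_apply, mul_comm _ (algebraMap ℂ (CoordRing l) _),
      ← Algebra.smul_def, AddMonoidAlgebra.coeff_smul_apply, smul_eq_mul]
    exact Finset.sum_congr rfl fun x _ => mul_comm _ _
  -- This is the coefficient of t^m in the gauge equation; exponentiating it loses m_k because
  -- exp(2πi m_k) = 1.
  have hW : ∀ m, ((m k : ℂ) • 1 + B k) * W m = W m * A k := by
    intro m
    rw [← hr, ← h k, add_mul, smul_mul_assoc, one_mul, ← hl]
    ext i j
    simp [W, coeff_eulerMap]
  have hexp : ∀ m, NormedSpace.exp ((2 * (Real.pi : ℂ) * Complex.I) • B k) * W m =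
      W m * NormedSpace.exp ((2 * (Real.pi : ℂ) * Complex.I) • A k) := by
    intro m
    have h1 := exp_mul_eq_mul_exp (X := (2 * (Real.pi : ℂ) * Complex.I) • ((m k : ℂ) • 1 + B k))
      (Y := (2 * (Real.pi : ℂ) * Complex.I) • A k) (W := W m)
      (by rw [smul_mul_assoc, hW, mul_smul_comm])
    rw [smul_add, Matrix.exp_add_of_commute _ _
      ((((Commute.one_left _).smul_left _).smul_left _)), smul_smul, exp_smul_one, mul_comm,
      mul_assoc, Complex.exp_int_mul_two_pi_mul_I, one_smul, one_mul] at h1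
    exact h1
  ext1 i j
  ext m
  exact congrFun (congrFun (((hl _ m).trans (hexp m)).trans (hr _ m).symm) i) j

/-! ### Isomorphisms of invariant D-modules -/

/-- Multiplication by G commutes with functions, and the gauge equation says that it intertwines the
Euler operators. The operators it intertwines form a subring, hence all of D(T). -/
lemma nonempty_linearEquiv_of_gaugeEquiv {M N : InvariantDModule l n}
    {A B : Fin l → Matrix (Fin n) (Fin n) ℂ}
    (hM : ∀ k, M.action (derOp (eulerDer k)) = covDer A k)
    (hN : ∀ k, N.action (derOp (eulerDer k)) = covDer B k) (h : GaugeEquiv A B) :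
    Nonempty (M.Carrier ≃ₗ[diffOps ℂ (CoordRing l)] N.Carrier) := by
  obtain ⟨G, H, hGH, hHG, h⟩ := h
  let L : Module.End ℂ (Fin n → CoordRing l) := G.mulVecLin.restrictScalars ℂ
  have hL : ∀ P : diffOps ℂ (CoordRing l), L * M.action P = N.action P * L := by
    let S : Subring (diffOps ℂ (CoordRing l)) :=
      { carrier := {P | L * M.action P = N.action P * L}
        mul_mem' := fun {P Q} hP hQ => by
          change L * M.action (P * Q) = N.action (P * Q) * L
          rw [map_mul, map_mul, ← mul_assoc, show L * M.action P = N.action P * L from hP,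
            mul_assoc, show L * M.action Q = N.action Q * L from hQ, mul_assoc]
        one_mem' := by
          change L * M.action 1 = N.action 1 * L
          rw [map_one, map_one, mul_one, one_mul]
        add_mem' := fun {P Q} hP hQ => by
          change L * M.action (P + Q) = N.action (P + Q) * L
          rw [map_add, map_add, mul_add, add_mul, show L * M.action P = N.action P * L from hP,
            show L * M.action Q = N.action Q * L from hQ]
        zero_mem' := by
          change L * M.action 0 = N.action 0 * L
          rw [map_zero, map_zero, mul_zero, zero_mul]
        neg_mem' := fun {P} hP => by
          change L * M.action (-P) = N.action (-P) * L
          have h1 : M.action (-P) = -M.action P := map_neg M.action P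
          have h2 : N.action (-P) = -N.action P := map_neg N.action P
          rw [h1, h2]
          exact LinearMap.ext fun s =>
            (map_neg L (M.action P s)).trans (congrArg Neg.neg (LinearMap.congr_fun hP s)) }
    refine diffOps_subring_eq_top S (fun f => ?_) (fun k => ?_)
    · change L * M.action (funOp ℂ f) = N.action (funOp ℂ f) * L
      refine LinearMap.ext fun s => ?_
      rw [Module.End.mul_apply, Module.End.mul_apply, M.action_funOp, N.action_funOp]
      exact Matrix.mulVec_smul G f s
    · change L * M.action (derOp (eulerDer k)) = N.action (derOp (eulerDer k)) * L
      rw [hM, hN]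
      refine LinearMap.ext fun s => ?_
      rw [Module.End.mul_apply, Module.End.mul_apply, covDer_apply, covDer_apply]
      change G.mulVec _ = (fun i => eulerMap k (G.mulVec s i)) + Matrix.mulVec _ (G.mulVec s)
      have h1 : (fun i => eulerMap k (G.mulVec s i)) =
          (G.map (eulerMap k)).mulVec s + G.mulVec fun i => eulerMap k (s i) := by
        funext i
        simp only [Matrix.mulVec, dotProduct, map_sum, eulerMap_mul, Pi.add_apply, Matrix.map_apply,
          Finset.sum_add_distrib]
      rw [h1, Matrix.mulVec_add, Matrix.mulVec_mulVec, Matrix.mulVec_mulVec, ← h k,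
        Matrix.add_mulVec]
      abel
  refine ⟨{ toFun := fun s => G.mulVec s, invFun := fun s => H.mulVec s
            map_add' := fun s s' => Matrix.mulVec_add G s s'
            map_smul' := fun P s => LinearMap.congr_fun (hL P) s
            left_inv := fun s => ?_, right_inv := fun s => ?_ }⟩
  · exact (Matrix.mulVec_mulVec s H G).trans (by rw [hHG]; exact Matrix.one_mulVec s)
  · exact (Matrix.mulVec_mulVec s G H).trans (by rw [hGH]; exact Matrix.one_mulVec s)

/-- An isomorphism of invariant D-modules is given by an invertible matrix of functions. -/
lemma InvariantDModule.exists_matrix {M N : InvariantDModule l n}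
    (e : M.Carrier →ₗ[diffOps ℂ (CoordRing l)] N.Carrier) :
    ∃ G : Matrix (Fin n) (Fin n) (CoordRing l), ∀ s : Fin n → CoordRing l, e s = G.mulVec s := by
  let E : (Fin n → CoordRing l) →ₗ[CoordRing l] (Fin n → CoordRing l) :=
    { toFun := fun s => e s
      map_add' := fun s s' => e.map_add s s'
      map_smul' := fun f s => by
        have h : e (M.action (funOp ℂ f) s) = N.action (funOp ℂ f) (e s) := e.map_smul (funOp ℂ f) s
        exact ((congrArg e (M.action_funOp f s)).symm.trans h).trans (N.action_funOp f (e s)) }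
  refine ⟨LinearMap.toMatrix' E, fun s => ?_⟩
  exact (LinearMap.toMatrix'_mulVec E s).symm

/-- A D(T)-linear map is ℂ[T]-linear, hence a matrix G. Comparing the actions of θ_k on the basis
vectors, whose components θ_k kills, gives the gauge equation column by column. -/
lemma gaugeEquiv_of_linearEquiv {M N : InvariantDModule l n}
    {A B : Fin l → Matrix (Fin n) (Fin n) ℂ}
    (hM : ∀ k, M.action (derOp (eulerDer k)) = covDer A k)
    (hN : ∀ k, N.action (derOp (eulerDer k)) = covDer B k)
    (e : M.Carrier ≃ₗ[diffOps ℂ (CoordRing l)] N.Carrier) : GaugeEquiv A B := by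
  obtain ⟨G, hG⟩ := InvariantDModule.exists_matrix e.toLinearMap
  obtain ⟨H, hH⟩ := InvariantDModule.exists_matrix e.symm.toLinearMap
  replace hG : ∀ s : Fin n → CoordRing l, e s = G.mulVec s := hG
  replace hH : ∀ s : Fin n → CoordRing l, e.symm s = H.mulVec s := hH
  refine ⟨G, H, ?_, ?_, fun k => ?_⟩
  · refine Matrix.ext_of_mulVec_single fun i => ?_
    rw [← Matrix.mulVec_mulVec, Matrix.one_mulVec]
    exact (congrArg G.mulVec (hH _)).symm.trans ((hG _).symm.trans (e.apply_symm_apply _))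
  · refine Matrix.ext_of_mulVec_single fun i => ?_
    rw [← Matrix.mulVec_mulVec, Matrix.one_mulVec]
    exact (congrArg H.mulVec (hG _)).symm.trans ((hH _).symm.trans (e.symm_apply_apply _))
  · refine Matrix.ext_of_mulVec_single fun j => ?_
    have h : e (M.action (derOp (eulerDer k)) (Pi.single j 1 : Fin n → CoordRing l)) =
        N.action (derOp (eulerDer k)) (e (Pi.single j 1 : Fin n → CoordRing l)) :=
      e.map_smul (derOp (eulerDer k)) (Pi.single j 1 : Fin n → CoordRing l)
    rw [hM, hN, hG, hG] at h
    have h2 : (fun i => eulerMap k ((Pi.single j 1 : Fin n → CoordRing l) i)) = 0 := by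
      funext i
      by_cases hij : i = j
      · subst hij
        rw [Pi.single_eq_same, ← map_one (algebraMap ℂ (CoordRing l)), eulerMap_algebraMap]
        rfl
      · simp [hij]
    rw [covDer_apply, h2, zero_add, Matrix.mulVec_mulVec] at h
    rw [h, covDer_apply, Matrix.mulVec_mulVec, Matrix.add_mulVec]
    congr 1
    funext i
    rw [Matrix.mulVec_single_one, Matrix.mulVec_single_one]
    rfl

/-! ### The exponential map -/

lemma Exp_eq_iff_gaugeEquiv (ρ σ : LieRep l n) :
    Exp ρ = Exp σ ↔ GaugeEquiv (fun k => ρ (eulerLie k)) (fun k => σ (eulerLie k)) := by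
  have hr : Exp ρ = Exp σ ↔ ∃ g : GL (Fin n) ℂ, ∀ i, (expTuple σ).1 i =
      g * (expTuple ρ).1 i * g⁻¹ := by
    rw [Exp, Exp]
    exact Quotient.eq (r := conjSetoid l n)
  rw [hr]
  constructor
  · rintro ⟨g, hg⟩
    have h1 : GaugeEquiv (fun k => ρ (eulerLie k))
        (fun k => g.1 * ρ (eulerLie k) * (g⁻¹).1) :=
      GaugeEquiv.conj g fun k => by rw [mul_assoc, Units.inv_mul, mul_one]
    refine h1.trans (GaugeEquiv.of_exp_eq (fun i j => ?_) (lieRep_commute σ) fun k => ?_)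
    · have h2 : ∀ X Y : Matrix (Fin n) (Fin n) ℂ,
          g.1 * X * (g⁻¹).1 * (g.1 * Y * (g⁻¹).1) = g.1 * (X * Y) * (g⁻¹).1 := by
        intro X Y
        simp only [mul_assoc, Units.inv_mul_cancel_left]
      change _ * _ = _ * _
      rw [h2, h2, (lieRep_commute ρ i j).eq]
    · rw [← smul_mul_assoc, ← mul_smul_comm, Matrix.exp_units_conj]
      exact (congrArg Units.val (hg k)).symm
  · rintro ⟨G, H, hGH, hHG, hgauge⟩
    -- G intertwines constant monodromy matrices, so its value at any point of the torus conjugates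
    -- them; the identity is chosen.
    let ε := (evalAt (1 : Torus l)).toRingHom.mapMatrix (m := Fin n)
    let g : GL (Fin n) ℂ := ⟨ε G, ε H, by rw [← map_mul, hGH, map_one],
      by rw [← map_mul, hHG, map_one]⟩
    refine ⟨g, fun k => ?_⟩
    rw [eq_mul_inv_iff_mul_eq]
    apply Units.ext
    have hε : ∀ C : Matrix (Fin n) (Fin n) ℂ, ε (C.map (algebraMap ℂ (CoordRing l))) = C := by
      intro C
      ext i j
      exact (evalAt (1 : Torus l)).commutes (C i j)
    have h := congrArg ε (hgauge.exp k)
    rw [map_mul, map_mul, hε, hε] at h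
    exact h

lemma Exp_surjective : Function.Surjective (Exp : LieRep l n → CommTupleClasses l n) := by
  intro q
  obtain ⟨⟨B, hB⟩, rfl⟩ := Quotient.exists_rep q
  choose R hR hRc using fun k => exists_two_pi_I_log (B k).isUnit
  -- Arbitrary logarithms of commuting matrices need not commute; those in the bicommutants do, by
  -- applying the property twice.
  have hBR : ∀ i j, Commute (B i).1 (R j) := fun i j =>
    hRc j _ (congrArg Units.val (hB i j).eq)
  have hRR : ∀ i j, Commute (R i) (R j) := fun i j => hRc j _ (hBR j i).symm
  obtain ⟨ρ, hρ⟩ := exists_lieRep hRR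
  refine ⟨ρ, ?_⟩
  rw [Exp]
  congr 1
  apply Subtype.ext
  funext k
  apply Units.ext
  change NormedSpace.exp _ = _
  rw [hρ, hR]

lemma Exp_eq_iff_nonempty_linearEquiv {M N : InvariantDModule l n} {ρ σ : LieRep l n}
    (hM : IsFormOf M.form ρ) (hN : IsFormOf N.form σ) :
    Exp ρ = Exp σ ↔ Nonempty (M.Carrier ≃ₗ[diffOps ℂ (CoordRing l)] N.Carrier) := by
  rw [Exp_eq_iff_gaugeEquiv]
  exact ⟨nonempty_linearEquiv_of_gaugeEquiv (M.action_eulerDer hM) (N.action_eulerDer hN),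
    fun ⟨e⟩ => gaugeEquiv_of_linearEquiv (M.action_eulerDer hM) (N.action_eulerDer hN) e⟩

/-- The bijection `ρ ↦ 𝕄_ρ`. -/
def lieRepEquiv (l n : ℕ) : LieRep l n ≃ InvariantDModule l n :=
  Equiv.ofBijective (fun ρ => (exists_invariantDModule ρ).choose) <| by
    refine ⟨fun ρ σ h => ?_, fun M => ?_⟩
    · have hρ := (exists_invariantDModule ρ).choose_spec
      have hσ := (exists_invariantDModule σ).choose_spec
      exact isFormOf_unique hρ ((congrArg (fun M => IsFormOf M.form σ) h).mpr hσ)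
    · obtain ⟨ρ, hρ⟩ := M.exists_isFormOf
      exact ⟨ρ, InvariantDModule.eq_of_isFormOf (exists_invariantDModule ρ).choose_spec hρ⟩

lemma isFormOf_lieRepEquiv (ρ : LieRep l n) : IsFormOf (lieRepEquiv l n ρ).form ρ :=
  (exists_invariantDModule ρ).choose_spec

lemma Exp_eq_iff (ρ σ : LieRep l n) : Exp ρ = Exp σ ↔
    Nonempty ((lieRepEquiv l n ρ).Carrier ≃ₗ[diffOps ℂ (CoordRing l)]
      (lieRepEquiv l n σ).Carrier) :=
  Exp_eq_iff_nonempty_linearEquiv (isFormOf_lieRepEquiv ρ) (isFormOf_lieRepEquiv σ)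

/-- The bijection from isomorphism classes of invariant D-modules to conjugacy classes of commuting
tuples induced by the exponential map. -/
def classesEquiv (l n : ℕ) : InvariantDModuleClasses l n ≃ CommTupleClasses l n :=
  Equiv.ofBijective
    (Quotient.lift (s := InvariantDModule.isoSetoid l n)
      (fun M => Exp ((lieRepEquiv l n).symm M)) fun M N h => by
        rw [Exp_eq_iff, Equiv.apply_symm_apply, Equiv.apply_symm_apply]
        exact h) <| by
    refine ⟨fun a b => ?_, fun q => ?_⟩
    · induction a using Quotient.inductionOn with | _ M
      induction b using Quotient.inductionOn with | _ N
      intro h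
      replace h : Exp ((lieRepEquiv l n).symm M) = Exp ((lieRepEquiv l n).symm N) := h
      rw [Exp_eq_iff, Equiv.apply_symm_apply, Equiv.apply_symm_apply] at h
      exact Quotient.sound h
    · obtain ⟨ρ, rfl⟩ := Exp_surjective q
      refine ⟨(lieRepEquiv l n ρ).isoClass, ?_⟩
      change Exp ((lieRepEquiv l n).symm _) = _
      rw [Equiv.symm_apply_apply]

lemma classesEquiv_isoClass (ρ : LieRep l n) :
    classesEquiv l n (lieRepEquiv l n ρ).isoClass = Exp ρ := by
  change Exp ((lieRepEquiv l n).symm _) = _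
  rw [Equiv.symm_apply_apply]

end Classification

end InvDMod

end

theorem theorem3 (l n : ℕ) :
    ∃ (𝕄 : InvDMod.LieRep l n ≃ InvDMod.InvariantDModule l n)
      (Φ : InvDMod.InvariantDModuleClasses l n ≃ InvDMod.CommTupleClasses l n),
      -- `𝕄 ρ` is the invariant D-module whose form restricts to `ρ` on `Lie T`
      (∀ ρ : InvDMod.LieRep l n, InvDMod.IsFormOf (𝕄 ρ).form ρ) ∧
      -- the bijection on isomorphism classes is induced by the exponential map
      (∀ ρ : InvDMod.LieRep l n, Φ (𝕄 ρ).isoClass = InvDMod.Exp ρ) ∧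
      Function.Surjective (InvDMod.Exp : InvDMod.LieRep l n → InvDMod.CommTupleClasses l n) ∧
      -- the fibers of the exponential map are exactly the isomorphism classes
      (∀ ρ σ : InvDMod.LieRep l n,
        InvDMod.Exp ρ = InvDMod.Exp σ ↔
          Nonempty ((𝕄 ρ).Carrier ≃ₗ[InvDMod.diffOps ℂ (InvDMod.CoordRing l)] (𝕄 σ).Carrier)) :=
  ⟨InvDMod.lieRepEquiv l n, InvDMod.classesEquiv l n, InvDMod.isFormOf_lieRepEquiv,
    InvDMod.classesEquiv_isoClass, InvDMod.Exp_surjective, InvDMod.Exp_eq_iff⟩
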